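/- Let $\overline M$ be a compact oriented 3-manifold whose boundary is a nonempty union of tori, and let $\tau$ be an ideal triangulation of $M=\overline M\setminus\partial\overline M$ by finitely many truncated tetrahedra, glued in pairs along all their hexagonal faces, so that $\partial\overline M$ is tiled by the cusp triangles (the truncations of the tips). A taut angle structure on $\tau$ assigns an angle $0$ or $\pi$ to each pair of opposite edges of each tetrahedron, such that the three angles of each tetrahedron have sum $\pi$ and the angles around each edge of $M$ have sum $2\pi$. Let $\theta$ be a taut angle structure on $\tau$ that is - veering: at each vertex $v$ of the tiling of $\partial\overline M$, either all cusp triangles with angle $0$ at $v$ have their $\pi$-angle immediately before $v$ in the counterclockwise order ($v$ is blue), or all of them have it immediately after $v$ ($v$ is red); and - transverse-taut: there is a transverse orientation of the faces of $\tau$, which we fix, such that in each tetrahedron the two faces sharing one of the $\pi$-edges point inward and the two faces sharing the other $\pi$-edge point outward. The edges of the tiling of $\partial\overline M$ that join vertices of the same color form disjoint closed curves, the ladderpoles. Their complement is a union of annuli, the ladders, in which consecutive triangles share edges (rungs) joining vertices of different colors. A ladder is ascending if in each of its triangles the $\pi$-angle is above the opposite side with respect to the transverse orientation, and descending if it is below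 in each of them. For an oriented closed curve $\gamma$ in $\partial\overline M$ transverse to the tiling, which enters and leaves each triangle through different edges, the deformation $D^\gamma$ is the sum, over all crossings of $\gamma$ with edges $e$ of the tiling, of the basis vector of the angle opposite $e$ in the triangle entered minus the basis vector of the angle opposite $e$ in the triangle left. For a ladder $L$ let $\gamma_L$ be the closed curve that runs once along $L$, traversing each triangle of $L$ exactly once and crossing only rungs, oriented such that it enters each triangle through a side between a $0$-angle and the $\pi$-angle and leaves it through the side between the two $0$-angles. Then the curves $\gamma_L$ exist for all ascending and all descending ladders, and $$\theta_1=\theta+\frac{\pi}{2}\sum_{L\text{ ascending}}D^{\gamma_L},\qquad \theta_2=\theta+\frac{\pi}{2}\sum_{L\text{ descending}}D^{\gamma_L}$$ are taut angle structures on $\tau$, and $\theta$, $\theta_1$, $\theta_2$ are pairwise distinct. In particular, $\tau$ carries at least two "exotic" taut angle structures distinct from the given one. -/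

import Mathlib

/-- An oriented ideal triangulation with set of tetrahedra `T`.  Every tetrahedron has its vertices
labelled by `Fin 4`, positively with respect to the orientation; face `i` is the face opposite
vertex `i`.  Face `i` of `t` is glued to a face of `adj t i`, and `glue t i` records the gluing:
a vertex `j ≠ i` of `t` is identified with the vertex `glue t i j` of `adj t i`, and `glue t i i`
is the label of the face of `adj t i` that face `i` is glued to. The faces are glued in pairs,
and all gluings reverse the induced orientation of the faces. -/
structure IdealTriangulation (T : Type*) where
  adj : T → Fin 4 → T
  glue : T → Fin 4 → Equiv.Perm (Fin 4)
  adj_adj : ∀ t i, adj (adj t i) (glue t i i) = t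
  glue_glue : ∀ t i, glue (adj t i) (glue t i i) = (glue t i)⁻¹
  not_self : ∀ t i, ¬ (adj t i = t ∧ glue t i i = i)
  orientation : ∀ t i, Equiv.Perm.sign (glue t i) = -1

/-- The three pairs of opposite edges of a tetrahedron, indexed by `Fin 3`: the pair that contains
the edge with (distinct) endpoints `a` and `b`. -/
def oppPair (a b : Fin 4) : Fin 3 :=
  if ({a, b} : Finset (Fin 4)) = {0, 1} ∨ ({a, b} : Finset (Fin 4)) = {2, 3} then 0
  else if ({a, b} : Finset (Fin 4)) = {0, 2} ∨ ({a, b} : Finset (Fin 4)) = {1, 3} then 1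
  else 2

/-- An angle vector: one real number for each pair of opposite edges of each tetrahedron. -/
abbrev AngleVector (T : Type*) := T → Fin 3 → ℝ

/-- A cusp triangle `(t, v)`: the triangle obtained by truncating vertex `v` of `t`.
Its three corners lie on the edges from `v` to the other vertices `w` of `t`, and are labelled by
these `w`.  Its side opposite the corner `w` lies in the face of `t` opposite `w`. -/
abbrev CuspTriangle (T : Type*) := T × Fin 4

/-- A corner of a cusp triangle: the corner of `(tet, cusp)` on the edge from `cusp` to `vert`. -/
@[ext]
structure Corner (T : Type*) where
  tet : T
  cusp : Fin 4
  vert : Fin 4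
  ne : vert ≠ cusp

noncomputable instance Corner.instFintype {T : Type*} [Fintype T] : Fintype (Corner T) :=
  Fintype.ofInjective (fun c : Corner T => (c.tet, c.cusp, c.vert)) (by
    intro c d h
    simp only [Prod.mk.injEq] at h
    exact Corner.ext h.1 h.2.1 h.2.2)

/-- The angle at a corner of a cusp triangle is the dihedral angle of the tetrahedron there. -/
def AngleVector.angle {T : Type*} (θ : AngleVector T) (c : Corner T) : ℝ :=
  θ c.tet (oppPair c.cusp c.vert)

/-- `CcwNext v w x`: in the triangle that truncates vertex `v` of a positively labelled
tetrahedron, the corner `x` immediately follows the corner `w` in the counterclockwise order. -/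
def CcwNext (v w x : Fin 4) : Prop :=
  ∃ p : Equiv.Perm (Fin 4), Equiv.Perm.sign p = 1 ∧ p 0 = v ∧ p 1 = w ∧ p 2 = x

namespace IdealTriangulation

variable {T : Type*} (𝒯 : IdealTriangulation T)

/-- The cusp triangle on the other side of the side of `x` opposite the corner `a`. -/
def across (x : CuspTriangle T) (a : Fin 4) : CuspTriangle T :=
  (𝒯.adj x.1 a, 𝒯.glue x.1 a x.2)

/-- Two corners that are adjacent across a side, opposite some `a`, of a cusp triangle. -/
def CornerAdj (c d : Corner T) : Prop :=
  ∃ a : Fin 4, a ≠ c.cusp ∧ a ≠ c.vert ∧ d.tet = 𝒯.adj c.tet a ∧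
    d.cusp = 𝒯.glue c.tet a c.cusp ∧ d.vert = 𝒯.glue c.tet a c.vert

/-- Two corners are at the same vertex of the tiling of the boundary by cusp triangles.  Such a
vertex is an end of an edge of the triangulation, and the corners at it are the dihedral angles
of tetrahedra that surround this edge. -/
def SameVertex (c d : Corner T) : Prop := Relation.EqvGen 𝒯.CornerAdj c d

open Classical in
/-- Generalized angle structures: the angles of each tetrahedron add up to `π`,
and the angles around each edge add up to `2π`. -/
def IsGeneralizedAngleStructure [Fintype T] (θ : AngleVector T) : Prop :=
  (∀ t, θ t 0 + θ t 1 + θ t 2 = Real.pi) ∧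
  (∀ c : Corner T, ∑ d : Corner T with 𝒯.SameVertex c d, θ.angle d = 2 * Real.pi)

/-- Taut angle structures: all angles are `0` or `π`. -/
def IsTautAngleStructure [Fintype T] (θ : AngleVector T) : Prop :=
  𝒯.IsGeneralizedAngleStructure θ ∧ ∀ t q, θ t q = 0 ∨ θ t q = Real.pi

/-- The vertex at which the corner `c` lies is left-veering: all triangles in its fans, i.e. those
that have a thin (zero) angle at the vertex, have their wide angle immediately before the vertex in
the counterclockwise order. -/
def LeftVeering (θ : AngleVector T) (c : Corner T) : Prop :=
  ∀ d, 𝒯.SameVertex c d → θ.angle d = 0 →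
    ∀ e : Corner T, e.tet = d.tet → e.cusp = d.cusp → CcwNext d.cusp e.vert d.vert →
      θ.angle e = Real.pi

/-- The vertex at which the corner `c` lies is right-veering: all triangles in its fans have their
wide angle immediately after the vertex in the counterclockwise order. -/
def RightVeering (θ : AngleVector T) (c : Corner T) : Prop :=
  ∀ d, 𝒯.SameVertex c d → θ.angle d = 0 →
    ∀ e : Corner T, e.tet = d.tet → e.cusp = d.cusp → CcwNext d.cusp d.vert e.vert →
      θ.angle e = Real.pi

/-- A (taut) angle structure is veering: every vertex is left-veering or right-veering. -/
def IsVeering (θ : AngleVector T) : Prop :=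
  ∀ c : Corner T, 𝒯.LeftVeering θ c ∨ 𝒯.RightVeering θ c

/-- A transverse orientation of the faces that makes the taut angle structure `θ` transverse-taut.
Here `into t i` says that the transverse orientation of face `i` of `t` points into `t`.  In each
tetrahedron, the two faces that share one of the `π`-edges (the faces `p 0`, `p 1`, with common
edge from `p 2` to `p 3`) point inward and the two faces that share the other one outward. -/
def IsTransverseTaut (θ : AngleVector T) (into : T → Fin 4 → Prop) : Prop :=
  (∀ t i, into t i ↔ ¬ into (𝒯.adj t i) (𝒯.glue t i i)) ∧
  (∀ t, ∃ p : Equiv.Perm (Fin 4),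
    θ t (oppPair (p 0) (p 1)) = Real.pi ∧ θ t (oppPair (p 2) (p 3)) = Real.pi ∧
      into t (p 0) ∧ into t (p 1) ∧ ¬ into t (p 2) ∧ ¬ into t (p 3))

/-- The side of the cusp triangle `x` opposite its corner `a` is a rung: its two endpoints have
different colors (red vertices are the right-veering ones, blue the left-veering ones).
The other sides are the ladderpole segments. -/
def IsRung (θ : AngleVector T) (x : CuspTriangle T) (a : Fin 4) : Prop :=
  a ≠ x.2 ∧ ∃ c d : Corner T, (c.tet, c.cusp) = x ∧ (d.tet, d.cusp) = x ∧
    c.vert ≠ a ∧ d.vert ≠ a ∧ 𝒯.RightVeering θ c ∧ 𝒯.LeftVeering θ d ∧ c ≠ d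

/-- Two cusp triangles have a rung as a common side. -/
def RungAdj (θ : AngleVector T) (x y : CuspTriangle T) : Prop :=
  ∃ a, 𝒯.IsRung θ x a ∧ y = 𝒯.across x a

/-- The ladders are the complementary annuli of the ladderpoles, given here as sets of cusp
triangles: the connected components of the cusp triangles under adjacency across rungs. -/
def IsLadder (θ : AngleVector T) (L : Set (CuspTriangle T)) : Prop :=
  ∃ x, L = {y | Relation.EqvGen (𝒯.RungAdj θ) x y}

/-- An oriented closed normal curve in the boundary, given by the cyclic sequence of the cusp
triangles that it traverses.  It enters the `i`-th triangle through the side opposite the corner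
`enter i`, leaves it through the side opposite the corner `leave i`, and then
enters the triangle number `i + 1` (modulo `n`) through that same side. -/
structure NormalCurve where
  n : ℕ
  [pos : NeZero n]
  tri : Fin n → CuspTriangle T
  enter : Fin n → Fin 4
  leave : Fin n → Fin 4
  enter_ne : ∀ i, enter i ≠ (tri i).2
  leave_ne : ∀ i, leave i ≠ (tri i).2
  enter_ne_leave : ∀ i, enter i ≠ leave i
  tri_succ : ∀ i, tri (i + 1) = 𝒯.across (tri i) (leave i)
  enter_succ : ∀ i, enter (i + 1) = 𝒯.glue (tri i).1 (leave i) (leave i)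

open Classical in
/-- The basis vector of the space of angle vectors for the angle at the corner `w` of `x`. -/
noncomputable def basisVector (x : CuspTriangle T) (w : Fin 4) : AngleVector T :=
  Pi.single x.1 (Pi.single (oppPair x.2 w) 1)

variable {𝒯} in
/-- The leading-trailing deformation of a normal curve: for each crossing of a side, plus the basis
vector of the angle opposite that side in the triangle entered, minus the basis vector of the
angle opposite that side in the triangle left (each crossing is the entrance into
one triangle and the exit from another). -/
noncomputable def NormalCurve.deformation (γ : 𝒯.NormalCurve) : AngleVector T :=
  ∑ i, (basisVector (γ.tri i) (γ.enter i) - basisVector (γ.tri i) (γ.leave i))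

variable {𝒯} in
/-- `γ` is an embedded curve that runs once along the ladder `L`: it traverses each triangle of `L`
exactly once, through the two rungs of the triangle.  It is oriented such that it enters each
triangle through a side between a zero angle and the `π`-angle (so opposite a zero angle), and
leaves it through the side between the two zero angles (opposite the `π`-angle). -/
def NormalCurve.RunsAlong (γ : 𝒯.NormalCurve) (θ : AngleVector T) (L : Set (CuspTriangle T)) :
    Prop :=
  Function.Injective γ.tri ∧ Set.range γ.tri = L ∧
  ∀ i, 𝒯.IsRung θ (γ.tri i) (γ.enter i) ∧ 𝒯.IsRung θ (γ.tri i) (γ.leave i) ∧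
    θ (γ.tri i).1 (oppPair (γ.tri i).2 (γ.enter i)) = 0 ∧
    θ (γ.tri i).1 (oppPair (γ.tri i).2 (γ.leave i)) = Real.pi

end IdealTriangulation

/-- The two types of ladders of a transverse-taut veering triangulation. -/
inductive LadderType where
  | ascending
  | descending

/-- The wide angle of the cusp triangle `x` is above its base (for `ascending`), respectively below
its base (for `descending`).  The base is the side opposite the wide corner `w`, which lies in
the face opposite `w`; up is the direction of the transverse orientation. -/
def LadderType.HasTriangle {T : Type*} (θ : AngleVector T) (into : T → Fin 4 → Prop)
    (x : CuspTriangle T) : LadderType → Prop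
  | .ascending => ∀ w, w ≠ x.2 → θ x.1 (oppPair x.2 w) = Real.pi → into x.1 w
  | .descending => ∀ w, w ≠ x.2 → θ x.1 (oppPair x.2 w) = Real.pi → ¬ into x.1 w

namespace IdealTriangulation

variable {T : Type*} (𝒯 : IdealTriangulation T)

/-- The ladders of a given type. -/
def LadderOfType (θ : AngleVector T) (into : T → Fin 4 → Prop) (k : LadderType) : Type _ :=
  {L : Set (CuspTriangle T) // 𝒯.IsLadder θ L ∧ ∀ x ∈ L, k.HasTriangle θ into x}

noncomputable instance instFintypeLadderOfType [Fintype T] (θ : AngleVector T)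
    (into : T → Fin 4 → Prop) (k : LadderType) : Fintype (𝒯.LadderOfType θ into k) :=
  @Fintype.ofFinite _ (inferInstanceAs (Finite {L : Set (CuspTriangle T) //
    𝒯.IsLadder θ L ∧ ∀ x ∈ L, k.HasTriangle θ into x}))

/-- `θ'` is obtained from `θ` by deforming, with weight `π / 2`, along all ladders of type `k`. -/
def IsLadderDeformation [Fintype T] (θ : AngleVector T) (into : T → Fin 4 → Prop)
    (k : LadderType) (θ' : AngleVector T) : Prop :=
  ∃ γ : 𝒯.LadderOfType θ into k → 𝒯.NormalCurve,
    (∀ L, (γ L).RunsAlong θ L.1) ∧ θ' = θ + (Real.pi / 2) • ∑ L, (γ L).deformation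

end IdealTriangulation

/-! In a cusp triangle, the corner after the wide one is blue and the corner before it is red. So
exactly two sides are rungs: the one opposite the wide corner `W x`, and the one opposite the thin
corner `E x` that has the colour of `W x`. A rung is opposite the wide corner in exactly one of its
two triangles. Hence crossing the side opposite `W x` is a permutation of the triangles
(`ladderStep`), whose cycles are the ladders and whose orbits are the curves.

Each triangle of a ladder contributes the basis vector at `E x` minus the one at `W x`. The type is
constant along a ladder, and in every tetrahedron the triangles of one type are those at the two
ends of one `π`-edge. Both contribute the same vector, so weight `π / 2` moves the whole angle `π`
to the thin pair with the colour of that `π`-edge (`IsLadderDeformation.apply`). Thus all angles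
remain `0` or `π`, and every tetrahedron changes. The angle sums around edges survive because the
deformation of any closed normal curve telescopes (`NormalCurve.sum_deformation_angle`).

The two new structures differ at a hinge, a tetrahedron whose `π`-edges have different colours, as
the two types then select different thin pairs. Without hinges, the majority colour of the edges of
a face would be constant over all tetrahedra around an edge. But a tetrahedron with red `π`-edges
has a blue thin edge, around which some tetrahedron has a blue `π`-edge; the same holds with the
colours exchanged (`exists_hinge`). -/

theorem oppPair_comm (a b : Fin 4) : oppPair a b = oppPair b a := by
  revert a b; decide

theorem oppPair_compl (a b c d : Fin 4) (hab : a ≠ b) (hac : a ≠ c) (had : a ≠ d)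
    (hbc : b ≠ c) (hbd : b ≠ d) (hcd : c ≠ d) : oppPair a b = oppPair c d := by
  have key : ∀ a b c d : Fin 4, (a ≠ b ∧ a ≠ c ∧ a ≠ d) ∧ (b ≠ c ∧ b ≠ d ∧ c ≠ d) →
      oppPair a b = oppPair c d := by decide
  exact key a b c d ⟨⟨hab, hac, had⟩, hbc, hbd, hcd⟩

theorem Fin.eq_or_of_four_distinct {a b c d : Fin 4} (hab : a ≠ b) (hac : a ≠ c) (had : a ≠ d)
    (hbc : b ≠ c) (hbd : b ≠ d) (hcd : c ≠ d) (v : Fin 4) : v = a ∨ v = b ∨ v = c ∨ v = d := by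
  have key : ∀ a b c d : Fin 4, (a ≠ b ∧ a ≠ c ∧ a ≠ d) ∧ (b ≠ c ∧ b ≠ d ∧ c ≠ d) →
      ∀ v, v = a ∨ v = b ∨ v = c ∨ v = d := by decide
  exact key a b c d ⟨⟨hab, hac, had⟩, hbc, hbd, hcd⟩ v

theorem oppPair_left_injective (a b c : Fin 4) (hab : a ≠ b) (hac : a ≠ c)
    (h : oppPair a b = oppPair a c) : b = c := by
  revert a b c; decide

theorem oppPair_eq_iff (a b c d v w : Fin 4) (hab : a ≠ b) (hac : a ≠ c) (had : a ≠ d)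
    (hbc : b ≠ c) (hbd : b ≠ d) (hcd : c ≠ d) (hvw : w ≠ v) :
    oppPair v w = oppPair a b ↔ (v = a ∧ w = b) ∨ (v = b ∧ w = a) ∨ (v = c ∧ w = d) ∨
      (v = d ∧ w = c) := by
  constructor
  · intro h
    rcases Fin.eq_or_of_four_distinct hab hac had hbc hbd hcd v with rfl | rfl | rfl | rfl
    · exact Or.inl ⟨rfl, oppPair_left_injective _ _ _ hvw.symm hab h⟩
    · rw [oppPair_comm a] at h
      exact Or.inr (Or.inl ⟨rfl, oppPair_left_injective _ _ _ hvw.symm hab.symm h⟩)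
    · rw [oppPair_compl _ _ _ _ hab hac had hbc hbd hcd] at h
      exact Or.inr (Or.inr (Or.inl ⟨rfl, oppPair_left_injective _ _ _ hvw.symm hcd h⟩))
    · rw [oppPair_compl _ _ _ _ hab hac had hbc hbd hcd] at h
      exact Or.inr (Or.inr (Or.inr ⟨rfl, oppPair_left_injective _ _ _ hvw.symm hcd.symm
        (h.trans (oppPair_comm _ _))⟩))
  · have := oppPair_compl a b c d hab hac had hbc hbd hcd
    rintro (⟨rfl, rfl⟩ | ⟨rfl, rfl⟩ | ⟨rfl, rfl⟩ | ⟨rfl, rfl⟩)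
    · rfl
    · exact oppPair_comm _ _
    · exact this.symm
    · rw [this]; exact oppPair_comm _ _

/-! ### Orientation-preserving labellings of a tetrahedron -/

/-- An even labelling of the vertices of a tetrahedron. -/
abbrev EvenFrame := {p : Equiv.Perm (Fin 4) // Equiv.Perm.sign p = 1}

namespace EvenFrame

/-- The frame with its labels permuted by an even permutation. -/
def relabel (p : EvenFrame) (s : Equiv.Perm (Fin 4)) (hs : Equiv.Perm.sign s = 1) : EvenFrame :=
  ⟨p.1 * s, by rw [Equiv.Perm.sign_mul, p.2, hs, one_mul]⟩

theorem ne (p : EvenFrame) {i j : Fin 4} (h : i ≠ j) : p.1 i ≠ p.1 j := p.1.injective.ne h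

theorem eq_or (p : EvenFrame) (a : Fin 4) : a = p.1 0 ∨ a = p.1 1 ∨ a = p.1 2 ∨ a = p.1 3 := by
  obtain ⟨i, rfl⟩ := p.1.surjective a
  fin_cases i <;> simp

/-- The corners `p 1`, `p 2`, `p 3` of the cusp `p 0` are in counterclockwise order; this rotation
lets any of them come first. -/
theorem exists_rotate (p : EvenFrame) :
    ∃ r : EvenFrame, r.1 0 = p.1 0 ∧ r.1 1 = p.1 2 ∧ r.1 2 = p.1 3 ∧ r.1 3 = p.1 1 :=
  ⟨p.relabel (Equiv.swap 1 2 * Equiv.swap 2 3) (by decide),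
    congrArg p.1 (by decide), congrArg p.1 (by decide), congrArg p.1 (by decide),
    congrArg p.1 (by decide)⟩

/-- The half turn exchanging the ends of the edge from `p 0` to `p 1`, which transfers facts at one
end to the other. -/
theorem exists_reverse (p : EvenFrame) :
    ∃ r : EvenFrame, r.1 0 = p.1 1 ∧ r.1 1 = p.1 0 ∧ r.1 2 = p.1 3 ∧ r.1 3 = p.1 2 :=
  ⟨p.relabel (Equiv.swap 0 1 * Equiv.swap 2 3) (by decide),
    congrArg p.1 (by decide), congrArg p.1 (by decide), congrArg p.1 (by decide),
    congrArg p.1 (by decide)⟩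

theorem exists_opposite (p : EvenFrame) :
    ∃ r : EvenFrame, r.1 0 = p.1 2 ∧ r.1 1 = p.1 3 ∧ r.1 2 = p.1 0 ∧ r.1 3 = p.1 1 :=
  ⟨p.relabel (Equiv.swap 0 2 * Equiv.swap 1 3) (by decide),
    congrArg p.1 (by decide), congrArg p.1 (by decide), congrArg p.1 (by decide),
    congrArg p.1 (by decide)⟩

theorem exists_oppPair (v : Fin 4) (q : Fin 3) :
    ∃ p : EvenFrame, p.1 0 = v ∧ oppPair (p.1 0) (p.1 1) = q := by
  obtain ⟨w, hw, rfl⟩ : ∃ w, w ≠ v ∧ oppPair v w = q := by revert v q; decide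
  obtain ⟨p, hp0, hp1⟩ : ∃ p : Equiv.Perm (Fin 4), p 0 = v ∧ p 1 = w := by
    revert v w; decide
  rcases Int.units_eq_one_or (Equiv.Perm.sign p) with h | h
  · exact ⟨⟨p, h⟩, hp0, by rw [hp0, hp1]⟩
  -- Only the images of `0` and `1` are prescribed, so the other two can be swapped to correct the
  -- parity.
  · refine ⟨⟨p * Equiv.swap 2 3, ?_⟩, ?_, ?_⟩
    · rw [Equiv.Perm.sign_mul, h]; decide
    · exact hp0
    · change oppPair (p 0) (p 1) = _
      rw [hp0, hp1]

theorem oppPair_opposite (p : EvenFrame) :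
    oppPair (p.1 2) (p.1 3) = oppPair (p.1 0) (p.1 1) ∧
    oppPair (p.1 1) (p.1 3) = oppPair (p.1 0) (p.1 2) ∧
    oppPair (p.1 1) (p.1 2) = oppPair (p.1 0) (p.1 3) := by
  refine ⟨?_, ?_, ?_⟩ <;> apply oppPair_compl <;> exact p.ne (by decide)

theorem oppPair_distinct (p : EvenFrame) :
    oppPair (p.1 0) (p.1 1) ≠ oppPair (p.1 0) (p.1 2) ∧
    oppPair (p.1 0) (p.1 1) ≠ oppPair (p.1 0) (p.1 3) ∧
    oppPair (p.1 0) (p.1 2) ≠ oppPair (p.1 0) (p.1 3) := by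
  refine ⟨fun h => ?_, fun h => ?_, fun h => ?_⟩ <;>
  · have := oppPair_left_injective _ _ _ (p.ne (by decide)) (p.ne (by decide)) h
    exact p.ne (by decide) this

end EvenFrame

/-! ### Colours of vertices and edges -/

/-- The corner at the other end of the same edge of the same tetrahedron. -/
def Corner.rev {T : Type*} (c : Corner T) : Corner T := ⟨c.tet, c.vert, c.cusp, c.ne.symm⟩

theorem AngleVector.angle_rev {T : Type*} (θ : AngleVector T) (c : Corner T) :
    θ.angle c.rev = θ.angle c := by
  unfold AngleVector.angle Corner.rev
  rw [oppPair_comm]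

/-- The corner of the cusp `v` of `t` labelled `w` exists and has the property `P`. -/
def HasCorner {T : Type*} (P : Corner T → Prop) (t : T) (v w : Fin 4) : Prop :=
  ∃ h : w ≠ v, P ⟨t, v, w, h⟩

namespace IdealTriangulation

variable {T : Type*} (𝒯 : IdealTriangulation T)

/-- Crossing a face turns an even frame into an odd one, so that two labels have to be swapped. -/
theorem exists_frame_across (t : T) (a : Fin 4) (p : EvenFrame) :
    ∃ r : EvenFrame, r.1 0 = 𝒯.glue t a (p.1 0) ∧ r.1 1 = 𝒯.glue t a (p.1 1) ∧
      r.1 2 = 𝒯.glue t a (p.1 3) ∧ r.1 3 = 𝒯.glue t a (p.1 2) :=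
  ⟨⟨𝒯.glue t a * p.1 * Equiv.swap 2 3, by
    rw [Equiv.Perm.sign_mul, Equiv.Perm.sign_mul, 𝒯.orientation, p.2]; decide⟩, rfl, rfl, rfl, rfl⟩

theorem across_across (x : CuspTriangle T) (a : Fin 4) :
    𝒯.across (𝒯.across x a) (𝒯.glue x.1 a a) = x := by
  unfold across
  ext1
  · exact 𝒯.adj_adj _ _
  · simp [𝒯.glue_glue]

/-- `CornerAdj` is symmetric in `cusp` and `vert`: the same tetrahedra surround both ends of an
edge. -/
theorem SameVertex.rev {𝒯 : IdealTriangulation T} {c d : Corner T} (h : 𝒯.SameVertex c d) :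
    𝒯.SameVertex c.rev d.rev := by
  unfold SameVertex at *
  induction h with
  | rel c d h =>
    obtain ⟨a, h1, h2, h3, h4, h5⟩ := h
    exact .rel _ _ ⟨a, h2, h1, h3, h5, h4⟩
  | refl => exact .refl _
  | symm _ _ _ ih => exact .symm _ _ ih
  | trans _ _ _ _ _ ih1 ih2 => exact .trans _ _ _ ih1 ih2

theorem hasCorner_across {P : Corner T → Prop} (hP : ∀ c d, 𝒯.SameVertex c d → (P c ↔ P d))
    (t : T) {a v w : Fin 4} (hv : a ≠ v) (hw : a ≠ w) :
    HasCorner P (𝒯.adj t a) (𝒯.glue t a v) (𝒯.glue t a w) ↔ HasCorner P t v w := by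
  have key (h : w ≠ v) : P ⟨t, v, w, h⟩ ↔
      P ⟨𝒯.adj t a, 𝒯.glue t a v, 𝒯.glue t a w, (𝒯.glue t a).injective.ne h⟩ :=
    hP _ _ (.rel _ _ ⟨a, hv, hw, rfl, rfl, rfl⟩)
  constructor
  · rintro ⟨h, hc⟩
    have h' : w ≠ v := fun e => h (by rw [e])
    exact ⟨h', (key h').2 hc⟩
  · rintro ⟨h, hc⟩
    exact ⟨_, (key h).1 hc⟩

theorem SameVertex.symm {𝒯 : IdealTriangulation T} {c d : Corner T} (h : 𝒯.SameVertex c d) :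
    𝒯.SameVertex d c := Relation.EqvGen.symm _ _ h

theorem SameVertex.trans {𝒯 : IdealTriangulation T} {c d e : Corner T} (h : 𝒯.SameVertex c d)
    (h' : 𝒯.SameVertex d e) : 𝒯.SameVertex c e := Relation.EqvGen.trans _ _ _ h h'

theorem sameVertex_congr (c : Corner T) (d e : Corner T) (h : 𝒯.SameVertex d e) :
    𝒯.SameVertex c d ↔ 𝒯.SameVertex c e :=
  ⟨fun h' => h'.trans h, fun h' => h'.trans h.symm⟩

theorem leftVeering_congr (θ : AngleVector T) (c d : Corner T) (h : 𝒯.SameVertex c d) :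
    𝒯.LeftVeering θ c ↔ 𝒯.LeftVeering θ d :=
  ⟨fun H e he => H e (h.trans he), fun H e he => H e (h.symm.trans he)⟩

theorem rightVeering_congr (θ : AngleVector T) (c d : Corner T) (h : 𝒯.SameVertex c d) :
    𝒯.RightVeering θ c ↔ 𝒯.RightVeering θ d :=
  ⟨fun H e he => H e (h.trans he), fun H e he => H e (h.symm.trans he)⟩

/-- The end at the cusp `v` of the edge of `t` from `v` to `w` is a blue (left-veering) vertex. -/
abbrev Blue (θ : AngleVector T) : T → Fin 4 → Fin 4 → Prop := HasCorner (𝒯.LeftVeering θ)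

/-- The end at the cusp `v` of the edge of `t` from `v` to `w` is a red (right-veering) vertex. -/
abbrev Red (θ : AngleVector T) : T → Fin 4 → Fin 4 → Prop := HasCorner (𝒯.RightVeering θ)

variable {𝒯} {θ : AngleVector T}

/-- Colour belongs to the edge, not just to one end. The half turn exchanging the ends of the edge
of `d` carries the edge of the preceding corner to its opposite edge, which has the same angle. -/
theorem LeftVeering.rev {c : Corner T} (hc : 𝒯.LeftVeering θ c) : 𝒯.LeftVeering θ c.rev := by
  intro d hd hz e het hec ⟨p, hp, hp0, hp1, hp2⟩
  have hp23 : p 3 ≠ p 2 := p.injective.ne (by decide)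
  have hcd : 𝒯.SameVertex c d.rev := hd.rev
  obtain ⟨r, r0, r1, r2, -⟩ := EvenFrame.exists_opposite ⟨p, hp⟩
  have := hc d.rev hcd (by rw [θ.angle_rev, hz]) ⟨d.tet, p 2, p 3, hp23⟩ rfl hp2
    ⟨r.1, r.2, r0.trans hp2, r1, r2.trans hp0⟩
  rw [← this]
  unfold AngleVector.angle
  rw [het, hec, ← hp0, ← hp1]
  dsimp only
  rw [(EvenFrame.oppPair_opposite ⟨p, hp⟩).1]

theorem RightVeering.rev {c : Corner T} (hc : 𝒯.RightVeering θ c) : 𝒯.RightVeering θ c.rev := by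
  intro d hd hz e het hec ⟨p, hp, hp0, hp1, hp2⟩
  have hp23 : p 3 ≠ p 1 := p.injective.ne (by decide)
  have hcd : 𝒯.SameVertex c d.rev := hd.rev
  obtain ⟨r, r0, r1, r2, -⟩ := EvenFrame.exists_reverse ⟨p, hp⟩
  have := hc d.rev hcd (by rw [θ.angle_rev, hz]) ⟨d.tet, p 1, p 3, hp23⟩ rfl hp1
    ⟨r.1, r.2, r0.trans hp1, r1.trans hp0, r2⟩
  rw [← this]
  unfold AngleVector.angle
  rw [het, hec, ← hp0, ← hp2]
  dsimp only
  rw [(EvenFrame.oppPair_opposite ⟨p, hp⟩).2.1]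

theorem Blue.symm {t : T} {v w : Fin 4} : 𝒯.Blue θ t v w → 𝒯.Blue θ t w v :=
  fun ⟨h, hc⟩ => ⟨h.symm, hc.rev⟩

theorem Red.symm {t : T} {v w : Fin 4} : 𝒯.Red θ t v w → 𝒯.Red θ t w v :=
  fun ⟨h, hc⟩ => ⟨h.symm, hc.rev⟩

variable (𝒯) in
theorem blue_across (t : T) {a v w : Fin 4} (hv : a ≠ v) (hw : a ≠ w) :
    𝒯.Blue θ (𝒯.adj t a) (𝒯.glue t a v) (𝒯.glue t a w) ↔ 𝒯.Blue θ t v w :=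
  𝒯.hasCorner_across (𝒯.leftVeering_congr θ) t hv hw

variable (𝒯) in
theorem red_across (t : T) {a v w : Fin 4} (hv : a ≠ v) (hw : a ≠ w) :
    𝒯.Red θ (𝒯.adj t a) (𝒯.glue t a v) (𝒯.glue t a w) ↔ 𝒯.Red θ t v w :=
  𝒯.hasCorner_across (𝒯.rightVeering_congr θ) t hv hw

theorem IsVeering.blue_or_red (hv : 𝒯.IsVeering θ) (t : T) {v w : Fin 4} (h : w ≠ v) :
    𝒯.Blue θ t v w ∨ 𝒯.Red θ t v w :=
  (hv ⟨t, v, w, h⟩).imp (fun H => ⟨h, H⟩) (fun H => ⟨h, H⟩)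

variable [Fintype T]

theorem IsTautAngleStructure.exists_wide (hθ : 𝒯.IsTautAngleStructure θ) (t : T) (v : Fin 4) :
    ∃ p : EvenFrame, p.1 0 = v ∧ θ t (oppPair (p.1 0) (p.1 1)) = Real.pi := by
  obtain ⟨q, hq⟩ : ∃ q, θ t q = Real.pi := by
    by_contra! h
    have h0 : ∀ q, θ t q = 0 := fun q => (hθ.2 t q).resolve_right (h q)
    have := hθ.1.1 t
    rw [h0, h0, h0] at this
    linarith [Real.pi_pos]
  obtain ⟨p, h0, h1⟩ := EvenFrame.exists_oppPair v q
  exact ⟨p, h0, by rw [h1, hq]⟩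

theorem IsTautAngleStructure.eq_of_wide (hθ : 𝒯.IsTautAngleStructure θ) {t : T} {q r : Fin 3}
    (hq : θ t q = Real.pi) (hr : θ t r = Real.pi) : q = r := by
  by_contra hne
  have h0 : ∀ s, 0 ≤ θ t s := fun s => by
    rcases hθ.2 t s with h | h <;> rw [h]
    exact Real.pi_pos.le
  have hs := hθ.1.1 t
  rw [← Fin.sum_univ_three] at hs
  have := Finset.sum_le_univ_sum_of_nonneg h0 (s := {q, r})
  rw [Finset.sum_pair hne, hq, hr, hs] at this
  linarith [Real.pi_pos]

theorem IsTautAngleStructure.thin (hθ : 𝒯.IsTautAngleStructure θ) {t : T} {q r : Fin 3}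
    (hq : θ t q = Real.pi) (hr : q ≠ r) : θ t r = 0 :=
  (hθ.2 t r).resolve_right fun h => hr (hθ.eq_of_wide hq h)

/-- The vertex immediately after the wide corner of a triangle is blue. -/
theorem blue_of_wide (hθ : 𝒯.IsTautAngleStructure θ) (hv : 𝒯.IsVeering θ) {t : T} (p : EvenFrame)
    (hp : θ t (oppPair (p.1 0) (p.1 1)) = Real.pi) : 𝒯.Blue θ t (p.1 0) (p.1 2) := by
  refine (hv.blue_or_red t (p.ne (by decide))).resolve_right fun ⟨h, H⟩ => ?_
  obtain ⟨r, r0, r1, r2, -⟩ := p.exists_rotate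
  -- If `p 2` were red, its successor `p 3` would be a second wide corner.
  have := H _ (.refl _) (hθ.thin hp p.oppPair_distinct.1)
    ⟨t, p.1 0, p.1 3, p.ne (by decide)⟩ rfl rfl ⟨r.1, r.2, r0, r1, r2⟩
  exact p.oppPair_distinct.2.1 (hθ.eq_of_wide hp this)

/-- The vertex immediately before the wide corner of a triangle is red. -/
theorem red_of_wide (hθ : 𝒯.IsTautAngleStructure θ) (hv : 𝒯.IsVeering θ) {t : T} (p : EvenFrame)
    (hp : θ t (oppPair (p.1 0) (p.1 1)) = Real.pi) : 𝒯.Red θ t (p.1 0) (p.1 3) := by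
  refine (hv.blue_or_red t (p.ne (by decide))).resolve_left fun ⟨h, H⟩ => ?_
  obtain ⟨r, r0, r1, r2, -⟩ := p.exists_rotate
  have := H _ (.refl _) (hθ.thin hp p.oppPair_distinct.2.1)
    ⟨t, p.1 0, p.1 2, p.ne (by decide)⟩ rfl rfl ⟨r.1, r.2, r0, r1, r2⟩
  exact p.oppPair_distinct.1 (hθ.eq_of_wide hp this)

/-- A thin corner of both colours would force both other corners of its triangle to be wide. -/
theorem not_blue_and_red_of_thin (hθ : 𝒯.IsTautAngleStructure θ) {t : T} {v w : Fin 4}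
    (hz : θ t (oppPair v w) = 0) (hb : 𝒯.Blue θ t v w) (hr : 𝒯.Red θ t v w) : False := by
  obtain ⟨h, hb⟩ := hb
  obtain ⟨_, hr⟩ := hr
  obtain ⟨p, rfl, hp⟩ := EvenFrame.exists_oppPair v (oppPair v w)
  obtain rfl := oppPair_left_injective _ _ _ (p.ne (by decide)) h.symm hp
  have h2 := hr _ (.refl _) hz ⟨t, p.1 0, p.1 2, p.ne (by decide)⟩ rfl rfl
    ⟨p.1, p.2, rfl, rfl, rfl⟩
  obtain ⟨r, r0, -, r2, r3⟩ := p.exists_rotate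
  obtain ⟨s, s0, s1, s2, -⟩ := r.exists_rotate
  have h3 := hb _ (.refl _) hz ⟨t, p.1 0, p.1 3, p.ne (by decide)⟩ rfl rfl
    ⟨s.1, s.2, s0.trans r0, s1.trans r2, s2.trans r3⟩
  exact p.oppPair_distinct.2.2 (hθ.eq_of_wide h2 h3)

/-- No vertex is both blue and red. -/
theorem not_blue_and_red (hθ : 𝒯.IsTautAngleStructure θ) (hv : 𝒯.IsVeering θ) {t : T}
    {v w : Fin 4} (hb : 𝒯.Blue θ t v w) (hr : 𝒯.Red θ t v w) : False := by
  rcases hθ.2 t (oppPair v w) with hz | hw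
  · exact not_blue_and_red_of_thin hθ hz hb hr
  obtain ⟨p, rfl, hp⟩ := EvenFrame.exists_oppPair v (oppPair v w)
  obtain rfl := oppPair_left_injective _ _ _ (p.ne (by decide)) hb.1.symm hp
  have h20 : p.1 2 ≠ p.1 0 := p.ne (by decide)
  have h21 : p.1 2 ≠ p.1 1 := p.ne (by decide)
  have h23 : p.1 2 ≠ p.1 3 := p.ne (by decide)
  -- At a wide corner, pass to the next triangle around the vertex. If its corner there is thin, the
  -- thin case applies. If it is wide too, the other end `p 3` of the crossed side is red seen from
  -- here and blue seen from there, while its corner here is thin.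
  obtain ⟨r, r0, r1, r2, -⟩ := 𝒯.exists_frame_across t (p.1 2) p
  rcases hθ.2 (𝒯.adj t (p.1 2)) (oppPair (r.1 0) (r.1 1)) with hz | hw'
  · rw [r0, r1] at hz
    exact not_blue_and_red_of_thin hθ hz ((𝒯.blue_across t h20 h21).2 hb)
      ((𝒯.red_across t h20 h21).2 hr)
  · have hb' := blue_of_wide hθ hv r hw'
    rw [r0, r2, 𝒯.blue_across t h20 h23] at hb'
    exact not_blue_and_red_of_thin hθ (hθ.thin hw p.oppPair_distinct.2.1) hb'
      (red_of_wide hθ hv p hw)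

end IdealTriangulation

/-! ### Rungs of a cusp triangle -/

namespace IdealTriangulation

variable {T : Type*} {𝒯 : IdealTriangulation T} {θ : AngleVector T}

theorem isRung_iff (x : CuspTriangle T) (a : Fin 4) :
    𝒯.IsRung θ x a ↔ a ≠ x.2 ∧ ∃ c d, c ≠ d ∧ c ≠ a ∧ d ≠ a ∧
      𝒯.Red θ x.1 x.2 c ∧ 𝒯.Blue θ x.1 x.2 d := by
  constructor
  · rintro ⟨ha, ⟨ct, cc, cv, hc⟩, ⟨dt, dc, dv, hd⟩, rfl, he, hca, hda, hr, hl, hne⟩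
    obtain ⟨rfl, rfl⟩ := Prod.mk.inj he
    exact ⟨ha, cv, dv, fun h => hne (by subst h; rfl), hca, hda, ⟨hc, hr⟩, ⟨hd, hl⟩⟩
  · rintro ⟨ha, c, d, hne, hca, hda, ⟨hc, hr⟩, ⟨hd, hl⟩⟩
    exact ⟨ha, _, _, rfl, rfl, hca, hda, hr, hl, fun h => hne (congrArg Corner.vert h)⟩

theorem IsRung.across {x : CuspTriangle T} {a : Fin 4} (h : 𝒯.IsRung θ x a) :
    𝒯.IsRung θ (𝒯.across x a) (𝒯.glue x.1 a a) := by
  rw [isRung_iff] at h ⊢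
  obtain ⟨ha, c, d, hne, hca, hda, hr, hb⟩ := h
  have hg := (𝒯.glue x.1 a).injective
  exact ⟨hg.ne ha, _, _, hg.ne hne, hg.ne hca, hg.ne hda,
    (𝒯.red_across x.1 ha hca.symm).2 hr, (𝒯.blue_across x.1 ha hda.symm).2 hb⟩

/-- The side opposite `a`, in the triangle truncating `v`, is a rung iff its ends `b` and `c` have
different colors. -/
theorem isRung_iff_of_distinct (t : T) {v a b c : Fin 4} (hva : v ≠ a) (hvb : v ≠ b) (hvc : v ≠ c)
    (hab : a ≠ b) (hac : a ≠ c) (hbc : b ≠ c) :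
    𝒯.IsRung θ (t, v) a ↔
      (𝒯.Red θ t v b ∧ 𝒯.Blue θ t v c) ∨ (𝒯.Blue θ t v b ∧ 𝒯.Red θ t v c) := by
  rw [isRung_iff]
  constructor
  · rintro ⟨-, r, l, hne, hr, hl, hR, hB⟩
    have h1 := Fin.eq_or_of_four_distinct hva hvb hvc hab hac hbc r
    have h2 := Fin.eq_or_of_four_distinct hva hvb hvc hab hac hbc l
    rcases h1 with rfl | rfl | rfl | rfl
    · exact absurd rfl hR.1
    · exact absurd rfl hr
    · rcases h2 with rfl | rfl | rfl | rfl
      · exact absurd rfl hB.1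
      · exact absurd rfl hl
      · exact absurd rfl hne
      · exact Or.inl ⟨hR, hB⟩
    · rcases h2 with rfl | rfl | rfl | rfl
      · exact absurd rfl hB.1
      · exact absurd rfl hl
      · exact Or.inr ⟨hB, hR⟩
      · exact absurd rfl hne
  · rintro (⟨hR, hB⟩ | ⟨hB, hR⟩)
    · exact ⟨hva.symm, b, c, hbc, hab.symm, hac.symm, hR, hB⟩
    · exact ⟨hva.symm, c, b, hbc.symm, hac.symm, hab.symm, hR, hB⟩

/-- `w` is the wide corner of the triangle `x`, and `e` is the thin corner of the color of `w`. -/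
structure WideThin (𝒯 : IdealTriangulation T) (θ : AngleVector T) (x : CuspTriangle T)
    (w e : Fin 4) : Prop where
  wide_ne : w ≠ x.2
  thin_ne : e ≠ x.2
  thin_ne_wide : e ≠ w
  wide : θ x.1 (oppPair x.2 w) = Real.pi
  isRung_iff : ∀ a, 𝒯.IsRung θ x a ↔ a = w ∨ a = e

variable [Fintype T]

/-- Counterclockwise from the wide corner the colours are red, blue, red, so the side opposite `p 2`
is the only one with ends of equal colour. -/
theorem wideThin_of_red (hθ : 𝒯.IsTautAngleStructure θ) (hv : 𝒯.IsVeering θ) {t : T}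
    (p : EvenFrame) (hp : θ t (oppPair (p.1 0) (p.1 1)) = Real.pi)
    (hr : 𝒯.Red θ t (p.1 0) (p.1 1)) : 𝒯.WideThin θ (t, p.1 0) (p.1 1) (p.1 3) := by
  have h01 : p.1 0 ≠ p.1 1 := p.ne (by decide)
  have h02 : p.1 0 ≠ p.1 2 := p.ne (by decide)
  have h03 : p.1 0 ≠ p.1 3 := p.ne (by decide)
  have h12 : p.1 1 ≠ p.1 2 := p.ne (by decide)
  have h13 : p.1 1 ≠ p.1 3 := p.ne (by decide)
  have h23 : p.1 2 ≠ p.1 3 := p.ne (by decide)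
  have hb2 := blue_of_wide hθ hv p hp
  have hr3 := red_of_wide hθ hv p hp
  refine ⟨h01.symm, h03.symm, h13.symm, hp, fun a => ⟨fun h => ?_, ?_⟩⟩
  · rcases p.eq_or a with rfl | rfl | rfl | rfl
    · exact absurd rfl h.1
    · exact Or.inl rfl
    · rw [isRung_iff_of_distinct t h02 h01 h03 h12.symm h23 h13] at h
      rcases h with ⟨-, h⟩ | ⟨h, -⟩
      · exact (not_blue_and_red hθ hv h hr3).elim
      · exact (not_blue_and_red hθ hv h hr).elim
    · exact Or.inr rfl
  · rintro (rfl | rfl)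
    · exact (isRung_iff_of_distinct t h01 h02 h03 h12 h13 h23).2 (Or.inr ⟨hb2, hr3⟩)
    · exact (isRung_iff_of_distinct t h03 h01 h02 h13.symm h23.symm h12).2 (Or.inl ⟨hr, hb2⟩)

theorem wideThin_of_blue (hθ : 𝒯.IsTautAngleStructure θ) (hv : 𝒯.IsVeering θ) {t : T}
    (p : EvenFrame) (hp : θ t (oppPair (p.1 0) (p.1 1)) = Real.pi)
    (hb : 𝒯.Blue θ t (p.1 0) (p.1 1)) : 𝒯.WideThin θ (t, p.1 0) (p.1 1) (p.1 2) := by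
  have h01 : p.1 0 ≠ p.1 1 := p.ne (by decide)
  have h02 : p.1 0 ≠ p.1 2 := p.ne (by decide)
  have h03 : p.1 0 ≠ p.1 3 := p.ne (by decide)
  have h12 : p.1 1 ≠ p.1 2 := p.ne (by decide)
  have h13 : p.1 1 ≠ p.1 3 := p.ne (by decide)
  have h23 : p.1 2 ≠ p.1 3 := p.ne (by decide)
  have hb2 := blue_of_wide hθ hv p hp
  have hr3 := red_of_wide hθ hv p hp
  refine ⟨h01.symm, h02.symm, h12.symm, hp, fun a => ⟨fun h => ?_, ?_⟩⟩
  · rcases p.eq_or a with rfl | rfl | rfl | rfl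
    · exact absurd rfl h.1
    · exact Or.inl rfl
    · exact Or.inr rfl
    · rw [isRung_iff_of_distinct t h03 h01 h02 h13.symm h23.symm h12] at h
      rcases h with ⟨h, -⟩ | ⟨-, h⟩
      · exact (not_blue_and_red hθ hv hb h).elim
      · exact (not_blue_and_red hθ hv hb2 h).elim
  · rintro (rfl | rfl)
    · exact (isRung_iff_of_distinct t h01 h02 h03 h12 h13 h23).2 (Or.inr ⟨hb2, hr3⟩)
    · exact (isRung_iff_of_distinct t h02 h01 h03 h12.symm h23 h13).2 (Or.inr ⟨hb, hr3⟩)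

theorem exists_wideThin (hθ : 𝒯.IsTautAngleStructure θ) (hv : 𝒯.IsVeering θ)
    (x : CuspTriangle T) : ∃ we : Fin 4 × Fin 4, 𝒯.WideThin θ x we.1 we.2 := by
  obtain ⟨t, v⟩ := x
  obtain ⟨p, rfl, hp⟩ := hθ.exists_wide t v
  rcases hv.blue_or_red t (p.ne (show (1 : Fin 4) ≠ 0 by decide)) with h | h
  · exact ⟨(_, _), wideThin_of_blue hθ hv p hp h⟩
  · exact ⟨(_, _), wideThin_of_red hθ hv p hp h⟩

theorem WideThin.thin (hθ : 𝒯.IsTautAngleStructure θ) {x : CuspTriangle T} {w e : Fin 4}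
    (h : 𝒯.WideThin θ x w e) : θ x.1 (oppPair x.2 e) = 0 :=
  hθ.thin h.wide fun he => h.thin_ne_wide
    (oppPair_left_injective _ _ _ h.wide_ne.symm h.thin_ne.symm he).symm

theorem WideThin.eq_wide (hθ : 𝒯.IsTautAngleStructure θ) {x : CuspTriangle T} {w e w' : Fin 4}
    (h : 𝒯.WideThin θ x w e) (hne : w' ≠ x.2) (hw' : θ x.1 (oppPair x.2 w') = Real.pi) :
    w' = w :=
  oppPair_left_injective _ _ _ hne.symm h.wide_ne.symm (hθ.eq_of_wide hw' h.wide)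

theorem WideThin.unique (hθ : 𝒯.IsTautAngleStructure θ) {x : CuspTriangle T} {w e w' e' : Fin 4}
    (h : 𝒯.WideThin θ x w e) (h' : 𝒯.WideThin θ x w' e') : w = w' ∧ e = e' := by
  have hw := h'.eq_wide hθ h.wide_ne h.wide
  refine ⟨hw, ((h'.isRung_iff e).1 ((h.isRung_iff e).2 (Or.inr rfl))).resolve_left ?_⟩
  rw [← hw]
  exact h.thin_ne_wide

/-- A rung is not opposite the wide corners of both adjacent triangles. -/
theorem not_wide_wide (hθ : 𝒯.IsTautAngleStructure θ) (hv : 𝒯.IsVeering θ) {t : T} {v w : Fin 4}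
    (hne : w ≠ v) (hw : θ t (oppPair v w) = Real.pi) :
    θ (𝒯.adj t w) (oppPair (𝒯.glue t w v) (𝒯.glue t w w)) ≠ Real.pi := by
  intro hw'
  obtain ⟨p, rfl, hp⟩ := EvenFrame.exists_oppPair v (oppPair v w)
  obtain rfl := oppPair_left_injective _ _ _ (p.ne (by decide)) hne.symm hp
  -- The gluing reverses orientation: the end `p 3` of the side comes before the wide corner here,
  -- but after the one across.
  obtain ⟨r, r0, r1, r2, -⟩ := 𝒯.exists_frame_across t (p.1 1) p
  have hb := blue_of_wide hθ hv r (by rw [r0, r1, hw'])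
  rw [r0, r2, 𝒯.blue_across t (p.ne (by decide)) (p.ne (by decide))] at hb
  exact not_blue_and_red hθ hv hb (red_of_wide hθ hv p hw)

/-- A rung is opposite the wide corner of one of the adjacent triangles. -/
theorem wide_across_thin (hθ : 𝒯.IsTautAngleStructure θ) (hv : 𝒯.IsVeering θ)
    {x : CuspTriangle T} {w e : Fin 4} (h : 𝒯.WideThin θ x w e) :
    θ (𝒯.adj x.1 e) (oppPair (𝒯.glue x.1 e x.2) (𝒯.glue x.1 e e)) = Real.pi := by
  obtain ⟨t, v⟩ := x
  obtain ⟨p, rfl, hp⟩ := hθ.exists_wide t v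
  obtain ⟨s, s0, hs⟩ := hθ.exists_wide (𝒯.adj t e) (𝒯.glue t e (p.1 0))
  have hb2 := blue_of_wide hθ hv p hp
  have hr3 := red_of_wide hθ hv p hp
  dsimp only
  rcases hv.blue_or_red t (p.ne (show (1 : Fin 4) ≠ 0 by decide)) with hc | hc
  · obtain ⟨-, rfl⟩ := h.unique hθ (wideThin_of_blue hθ hv p hp hc)
    have h20 : p.1 2 ≠ p.1 0 := p.ne (by decide)
    have h21 : p.1 2 ≠ p.1 1 := p.ne (by decide)
    have h23 : p.1 2 ≠ p.1 3 := p.ne (by decide)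
    obtain ⟨r, r0, r1, r2, r3⟩ := 𝒯.exists_frame_across t (p.1 2) p
    -- If the wide corner across the rung were at an end of the rung, it would force on the other
    -- end the wrong colour. So it is opposite the rung.
    rcases r.eq_or (s.1 1) with h1 | h1 | h1 | h1
    · exact absurd (h1.trans (r0.trans s0.symm)) (s.ne (by decide))
    · rw [s0, h1, ← r0] at hs
      have := blue_of_wide hθ hv r hs
      rw [r0, r2, 𝒯.blue_across t h20 h23] at this
      exact (not_blue_and_red hθ hv this hr3).elim
    · obtain ⟨q, q0, q1, -, q3⟩ := r.exists_rotate
      rw [s0, h1, ← r0, ← q0, ← q1] at hs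
      have := red_of_wide hθ hv q hs
      rw [q0, q3, r0, r1, 𝒯.red_across t h20 h21] at this
      exact (not_blue_and_red hθ hv hc this).elim
    · rw [← hs, s0, h1, r3]
  · obtain ⟨-, rfl⟩ := h.unique hθ (wideThin_of_red hθ hv p hp hc)
    have h30 : p.1 3 ≠ p.1 0 := p.ne (by decide)
    have h31 : p.1 3 ≠ p.1 1 := p.ne (by decide)
    have h32 : p.1 3 ≠ p.1 2 := p.ne (by decide)
    obtain ⟨r, r0, r1, r2, r3⟩ := 𝒯.exists_frame_across t (p.1 3) p
    rcases r.eq_or (s.1 1) with h1 | h1 | h1 | h1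
    · exact absurd (h1.trans (r0.trans s0.symm)) (s.ne (by decide))
    · rw [s0, h1, ← r0] at hs
      have := red_of_wide hθ hv r hs
      rw [r0, r3, 𝒯.red_across t h30 h32] at this
      exact (not_blue_and_red hθ hv hb2 this).elim
    · rw [← hs, s0, h1, r2]
    · obtain ⟨q, q0, q1, q2, q3⟩ := r.exists_rotate
      obtain ⟨u, u0, u1, u2, u3⟩ := q.exists_rotate
      rw [s0, h1, ← r0, ← q0, ← q2, ← u0, ← u1] at hs
      have := blue_of_wide hθ hv u hs
      rw [u0, u2, q0, q3, r0, r1, 𝒯.blue_across t h30 h31] at this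
      exact (not_blue_and_red hθ hv this hc).elim

/-- The labels of the wide corner and of the thin corner of the same color of a triangle. -/
theorem exists_wideThin_fun (hθ : 𝒯.IsTautAngleStructure θ) (hv : 𝒯.IsVeering θ) :
    ∃ W E : CuspTriangle T → Fin 4, ∀ x, 𝒯.WideThin θ x (W x) (E x) := by
  choose f hf using exists_wideThin hθ hv
  exact ⟨fun x => (f x).1, fun x => (f x).2, hf⟩

/-! ### Ladders as cycles of a permutation -/

section Ladder

variable {W E : CuspTriangle T → Fin 4}

/-- Seen from the neighbour, a rung is again a rung, hence opposite its `W` or its `E`, and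
`not_wide_wide` excludes `W`. -/
theorem thin_across_wide (hθ : 𝒯.IsTautAngleStructure θ) (hv : 𝒯.IsVeering θ)
    (h : ∀ x, 𝒯.WideThin θ x (W x) (E x)) (x : CuspTriangle T) :
    E (𝒯.across x (W x)) = 𝒯.glue x.1 (W x) (W x) := by
  have hr := (((h x).isRung_iff _).2 (Or.inl rfl)).across
  refine ((((h _).isRung_iff _).1 hr).resolve_left fun he => ?_).symm
  refine not_wide_wide (𝒯 := 𝒯) hθ hv (h x).wide_ne (h x).wide ?_
  rw [he]
  exact (h (𝒯.across x (W x))).wide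

theorem wide_across_thin_eq (hθ : 𝒯.IsTautAngleStructure θ) (hv : 𝒯.IsVeering θ)
    (h : ∀ x, 𝒯.WideThin θ x (W x) (E x)) (x : CuspTriangle T) :
    W (𝒯.across x (E x)) = 𝒯.glue x.1 (E x) (E x) :=
  ((h _).eq_wide hθ ((𝒯.glue x.1 (E x)).injective.ne (h x).thin_ne)
    (wide_across_thin hθ hv (h x))).symm

/-- The permutation that moves every triangle one step forward along its ladder. -/
noncomputable def ladderStep (hθ : 𝒯.IsTautAngleStructure θ) (hv : 𝒯.IsVeering θ)
    (h : ∀ x, 𝒯.WideThin θ x (W x) (E x)) : Equiv.Perm (CuspTriangle T) where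
  toFun x := 𝒯.across x (W x)
  invFun x := 𝒯.across x (E x)
  left_inv x := by
    dsimp only
    rw [thin_across_wide hθ hv h, 𝒯.across_across]
  right_inv x := by
    dsimp only
    rw [wide_across_thin_eq hθ hv h, 𝒯.across_across]

/-- A triangle has only two rungs; crossing one is a step forward, crossing the other a step back.
-/
theorem eqvGen_rungAdj_iff (hθ : 𝒯.IsTautAngleStructure θ) (hv : 𝒯.IsVeering θ)
    (h : ∀ x, 𝒯.WideThin θ x (W x) (E x)) (x y : CuspTriangle T) :
    Relation.EqvGen (𝒯.RungAdj θ) x y ↔ (ladderStep hθ hv h).SameCycle x y := by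
  have hstep (x) : Relation.EqvGen (𝒯.RungAdj θ) x (ladderStep hθ hv h x) :=
    .rel _ _ ⟨W x, ((h x).isRung_iff _).2 (Or.inl rfl), rfl⟩
  constructor
  · intro H
    induction H with
    | rel x y H =>
      obtain ⟨a, ha, rfl⟩ := H
      rcases ((h x).isRung_iff _).1 ha with rfl | rfl
      · exact Equiv.Perm.sameCycle_apply_right.2 (.refl _ _)
      · exact (Equiv.Perm.sameCycle_symm_apply_right (f := ladderStep hθ hv h)).2 (.refl _ _)
    | refl => exact .refl _ _
    | symm _ _ _ ih => exact ih.symm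
    | trans _ _ _ _ _ ih1 ih2 => exact ih1.trans ih2
  · intro H
    obtain ⟨n, rfl⟩ := H.exists_nat_pow_eq
    induction n with
    | zero => exact .refl _
    | succ n ih =>
      rw [pow_succ', Equiv.Perm.mul_apply]
      exact .trans _ _ _ (ih ⟨n, by simp⟩) (hstep _)

/-- The closed curve that starts at `x` and runs forward along the ladder. -/
noncomputable def ladderCurve (hθ : 𝒯.IsTautAngleStructure θ) (hv : 𝒯.IsVeering θ)
    (h : ∀ x, 𝒯.WideThin θ x (W x) (E x)) (x : CuspTriangle T) : 𝒯.NormalCurve :=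
  have hpos : 0 < Function.minimalPeriod (ladderStep hθ hv h) x :=
    Function.minimalPeriod_pos_of_mem_periodicPts
      ((ladderStep hθ hv h).injective.mem_periodicPts x)
  have : NeZero (Function.minimalPeriod (ladderStep hθ hv h) x) := ⟨hpos.ne'⟩
  have hsucc (i : Fin (Function.minimalPeriod (ladderStep hθ hv h) x)) :
      (ladderStep hθ hv h)^[(i + 1 : Fin _)] x =
        𝒯.across ((ladderStep hθ hv h)^[i] x) (W ((ladderStep hθ hv h)^[i] x)) := by
    -- Both the sum and the `1` are reduced modulo the period (for period one, `1` is `0`), which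
    -- does not affect the iterates at `x`.
    rw [Fin.val_add, Function.iterate_mod_minimalPeriod_eq, Fin.val_one', Function.iterate_add_apply,
      Function.iterate_mod_minimalPeriod_eq, ← Function.iterate_add_apply,
      Function.iterate_succ_apply']
    rfl
  { n := Function.minimalPeriod (ladderStep hθ hv h) x
    tri i := (ladderStep hθ hv h)^[i] x
    enter i := E ((ladderStep hθ hv h)^[i] x)
    leave i := W ((ladderStep hθ hv h)^[i] x)
    enter_ne i := (h _).thin_ne
    leave_ne i := (h _).wide_ne
    enter_ne_leave i := (h _).thin_ne_wide
    tri_succ := hsucc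
    enter_succ i := by
      rw [hsucc i]
      exact thin_across_wide hθ hv h _ }

theorem ladderCurve_runsAlong (hθ : 𝒯.IsTautAngleStructure θ) (hv : 𝒯.IsVeering θ)
    (h : ∀ x, 𝒯.WideThin θ x (W x) (E x)) (x : CuspTriangle T) :
    (ladderCurve hθ hv h x).RunsAlong θ {y | Relation.EqvGen (𝒯.RungAdj θ) x y} := by
  refine ⟨fun i j hij => ?_, ?_, fun i => ⟨((h _).isRung_iff _).2 (Or.inr rfl),
    ((h _).isRung_iff _).2 (Or.inl rfl), (h _).thin hθ, (h _).wide⟩⟩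
  · exact Fin.ext (Function.iterate_injOn_Iio_minimalPeriod i.2 j.2 hij)
  · ext y
    rw [Set.mem_ofPred_eq, eqvGen_rungAdj_iff hθ hv h]
    constructor
    · rintro ⟨i, rfl⟩
      refine ⟨(i : ℕ), ?_⟩
      rw [zpow_natCast, Equiv.Perm.coe_pow]
      rfl
    · intro H
      obtain ⟨n, rfl⟩ := H.exists_nat_pow_eq
      have hpos : 0 < Function.minimalPeriod (ladderStep hθ hv h) x :=
        Function.minimalPeriod_pos_of_mem_periodicPts
          ((ladderStep hθ hv h).injective.mem_periodicPts x)
      refine ⟨(⟨n % _, Nat.mod_lt n hpos⟩ : Fin (Function.minimalPeriod _ x)), ?_⟩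
      rw [Equiv.Perm.coe_pow]
      exact Function.iterate_mod_minimalPeriod_eq

/-- The angle conditions fix the direction of the curve, so its deformation depends on the ladder
alone. -/
theorem enter_leave_eq_of_runsAlong {γ : 𝒯.NormalCurve} {L : Set (CuspTriangle T)}
    (hθ : 𝒯.IsTautAngleStructure θ) (h : ∀ x, 𝒯.WideThin θ x (W x) (E x))
    (hγ : γ.RunsAlong θ L) (i : Fin γ.n) :
    γ.enter i = E (γ.tri i) ∧ γ.leave i = W (γ.tri i) := by
  obtain ⟨-, -, hi⟩ := hγ
  have hl := (h _).eq_wide hθ (γ.leave_ne i) (hi i).2.2.2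
  refine ⟨(((h _).isRung_iff _).1 (hi i).1).resolve_left fun he => ?_, hl⟩
  exact γ.enter_ne_leave i (he.trans hl.symm)

open Classical in
/-- The deformation along a ladder is a sum over the triangles of the ladder. -/
theorem deformation_eq_sum {γ : 𝒯.NormalCurve} {L : Set (CuspTriangle T)}
    (hθ : 𝒯.IsTautAngleStructure θ) (h : ∀ x, 𝒯.WideThin θ x (W x) (E x))
    (hγ : γ.RunsAlong θ L) :
    γ.deformation = ∑ x with x ∈ L, (basisVector x (E x) - basisVector x (W x)) := by
  have hL : Finset.univ.filter (· ∈ L) = Finset.univ.map ⟨γ.tri, hγ.1⟩ := by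
    ext x
    simp [← hγ.2.1]
  rw [hL, Finset.sum_map]
  refine Finset.sum_congr rfl fun i _ => ?_
  obtain ⟨he, hl⟩ := enter_leave_eq_of_runsAlong hθ h hγ i
  rw [he, hl]
  rfl

end Ladder

end IdealTriangulation

/-! ### Invariance of the angle sums around edges -/

namespace IdealTriangulation

variable {T : Type*} {𝒯 : IdealTriangulation T}

open Classical in
/-- The number of ends of the edge of `t` from `v` to `w` whose corner has the property `P`. -/
noncomputable def edgeCount (P : Corner T → Prop) (t : T) (v w : Fin 4) : ℝ :=
  (if HasCorner P t v w then 1 else 0) + (if HasCorner P t w v then 1 else 0)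

theorem edgeCount_comm (P : Corner T → Prop) (t : T) (v w : Fin 4) :
    edgeCount P t v w = edgeCount P t w v := add_comm _ _

theorem edgeCount_across {P : Corner T → Prop} (hP : ∀ c d, 𝒯.SameVertex c d → (P c ↔ P d))
    (t : T) {a v w : Fin 4} (hv : a ≠ v) (hw : a ≠ w) :
    edgeCount P (𝒯.adj t a) (𝒯.glue t a v) (𝒯.glue t a w) = edgeCount P t v w := by
  rw [edgeCount, edgeCount, propext (𝒯.hasCorner_across hP t hv hw),
    propext (𝒯.hasCorner_across hP t hw hv)]

open Classical in
theorem basisVector_apply (x : CuspTriangle T) (a : Fin 4) (t : T) (q : Fin 3)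
    [Decidable (t = x.1)] :
    basisVector x a t q = if t = x.1 ∧ oppPair x.2 a = q then 1 else 0 := by
  unfold basisVector
  by_cases h : t = x.1
  · subst h
    by_cases hq : oppPair x.2 a = q
    · subst hq
      rw [Pi.single_eq_same, Pi.single_eq_same, if_pos ⟨rfl, rfl⟩]
    · rw [Pi.single_eq_same, Pi.single_eq_of_ne (Ne.symm hq), if_neg fun H => hq H.2]
  · rw [Pi.single_eq_of_ne h, if_neg fun H => h H.1]
    rfl

open Classical in
-- One angle coordinate is read at four corners: both ends of each of two opposite edges.
theorem sum_basisVector_angle [Fintype T] (P : Corner T → Prop) (t : T) {a b c d : Fin 4} (hab : a ≠ b)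
    (hac : a ≠ c) (had : a ≠ d) (hbc : b ≠ c) (hbd : b ≠ d) (hcd : c ≠ d) :
    ∑ e with P e, (basisVector (t, a) b).angle e = edgeCount P t a b + edgeCount P t c d := by
  have hset : Finset.univ.filter (fun e : Corner T => e.tet = t ∧
      oppPair a b = oppPair e.cusp e.vert) = {⟨t, a, b, hab.symm⟩, ⟨t, b, a, hab⟩,
        ⟨t, c, d, hcd.symm⟩, ⟨t, d, c, hcd⟩} := by
    ext ⟨s, v, w, h⟩
    have := oppPair_eq_iff a b c d v w hab hac had hbc hbd hcd h
    simp only [Finset.mem_filter, Finset.mem_univ, true_and, Finset.mem_insert,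
      Finset.mem_singleton, Corner.mk.injEq, eq_comm (a := oppPair a b), this,
      and_or_left]
  have hsum : ∑ e with P e, (basisVector (t, a) b).angle e =
      ∑ e : Corner T with e.tet = t ∧ oppPair a b = oppPair e.cusp e.vert,
        if P e then (1 : ℝ) else 0 := by
    rw [Finset.sum_filter, Finset.sum_filter]
    refine Finset.sum_congr rfl fun e _ => ?_
    rw [AngleVector.angle, basisVector_apply]
    split_ifs <;> rfl
  have hi (v w : Fin 4) (h : w ≠ v) : (if P ⟨t, v, w, h⟩ then (1 : ℝ) else 0) =
      if HasCorner P t v w then 1 else 0 := by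
    simp [HasCorner, h]
  rw [hsum, hset, Finset.sum_insert (by simp [hab, hac, had]),
    Finset.sum_insert (by simp [hbc, hbd]), Finset.sum_insert (by simp [hcd]),
    Finset.sum_singleton, hi, hi, hi, hi, edgeCount, edgeCount]
  ring

/-- For the crossing of a side in the triangle truncating `u` of `t`, with ends at `b` and `c`:
the number of ends of the side that lie at the given vertices, with a correction for the third edge
of the face. -/
noncomputable def crossingCount (P : Corner T → Prop) (t : T) (u b c : Fin 4) : ℝ :=
  edgeCount P t u b + edgeCount P t u c - edgeCount P t b c

theorem crossingCount_comm (P : Corner T → Prop) (t : T) (u b c : Fin 4) :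
    crossingCount P t u b c = crossingCount P t u c b := by
  unfold crossingCount
  rw [edgeCount_comm P t b c]
  ring

theorem exists_fourth {a b c : Fin 4} (hab : a ≠ b) (hac : a ≠ c) (hbc : b ≠ c) :
    ∃ d, a ≠ d ∧ b ≠ d ∧ c ≠ d := by
  revert a b c; decide

open Classical in
/-- A deformation along a normal curve does not change the angle sums around the edges. -/
theorem NormalCurve.sum_deformation_angle [Fintype T] (γ : 𝒯.NormalCurve) {P : Corner T → Prop}
    (hP : ∀ c d, 𝒯.SameVertex c d → (P c ↔ P d)) :
    ∑ e with P e, γ.deformation.angle e = 0 := by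
  have := γ.pos
  choose r hr1 hr2 hr3 using fun i =>
    exists_fourth (γ.enter_ne i).symm (γ.leave_ne i).symm (γ.enter_ne_leave i)
  -- Adding and subtracting the count of the edge from the cusp to the third corner `r i` splits the
  -- contribution into a term of the exit face minus a term of the entry face.
  have hsum : ∑ e with P e, γ.deformation.angle e =
      ∑ i, (crossingCount P (γ.tri i).1 (γ.tri i).2 (γ.enter i) (r i) -
        crossingCount P (γ.tri i).1 (γ.tri i).2 (γ.leave i) (r i)) := by
    have (e : Corner T) : γ.deformation.angle e = ∑ i, ((basisVector (γ.tri i) (γ.enter i)).angle e -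
        (basisVector (γ.tri i) (γ.leave i)).angle e) := by
      simp [NormalCurve.deformation, AngleVector.angle, Finset.sum_apply]
    simp only [this]
    rw [Finset.sum_comm]
    refine Finset.sum_congr rfl fun i _ => ?_
    have he := sum_basisVector_angle P (γ.tri i).1 (γ.enter_ne i).symm (γ.leave_ne i).symm (hr1 i)
      (γ.enter_ne_leave i) (hr2 i) (hr3 i)
    have hl := sum_basisVector_angle P (γ.tri i).1 (γ.leave_ne i).symm (γ.enter_ne i).symm (hr1 i)
      (γ.enter_ne_leave i).symm (hr3 i) (hr2 i)
    rw [Finset.sum_sub_distrib, he, hl]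
    unfold crossingCount
    ring
  -- The entry term of a triangle is the exit term of the preceding one, since both describe the
  -- same face. Hence the cyclic sum telescopes.
  have hstep (i) : crossingCount P (γ.tri (i + 1)).1 (γ.tri (i + 1)).2 (γ.leave (i + 1)) (r (i + 1))
      = crossingCount P (γ.tri i).1 (γ.tri i).2 (γ.enter i) (r i) := by
    have hg := (𝒯.glue (γ.tri i).1 (γ.leave i)).injective
    have hu : (γ.tri (i + 1)).2 = 𝒯.glue (γ.tri i).1 (γ.leave i) (γ.tri i).2 := by
      rw [γ.tri_succ]; rfl
    have ht : (γ.tri (i + 1)).1 = 𝒯.adj (γ.tri i).1 (γ.leave i) := by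
      rw [γ.tri_succ]; rfl
    have hcross : crossingCount P (𝒯.adj (γ.tri i).1 (γ.leave i))
        (𝒯.glue (γ.tri i).1 (γ.leave i) (γ.tri i).2)
        (𝒯.glue (γ.tri i).1 (γ.leave i) (γ.enter i)) (𝒯.glue (γ.tri i).1 (γ.leave i) (r i)) =
        crossingCount P (γ.tri i).1 (γ.tri i).2 (γ.enter i) (r i) := by
      unfold crossingCount
      rw [edgeCount_across hP _ (γ.leave_ne i) (γ.enter_ne_leave i).symm,
        edgeCount_across hP _ (γ.leave_ne i) (hr3 i),
        edgeCount_across hP _ (γ.enter_ne_leave i).symm (hr3 i)]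
    have hor := Fin.eq_or_of_four_distinct (hg.ne (γ.leave_ne i).symm) (hg.ne (γ.enter_ne i).symm)
      (hg.ne (hr1 i)) (hg.ne (γ.enter_ne_leave i).symm) (hg.ne (hr3 i)) (hg.ne (hr2 i))
    have hl1 := γ.leave_ne (i + 1)
    have hl2 := γ.enter_ne_leave (i + 1)
    have hr1' := hr1 (i + 1)
    have hr2' := hr2 (i + 1)
    have hr3' := hr3 (i + 1)
    rw [γ.enter_succ] at hl2 hr2'
    rw [hu] at hl1 hr1'
    rw [ht, hu]
    -- The curve turns around one of the two ends of the crossed side; the choice only exchanges the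
    -- arguments of `crossingCount`.
    rcases hor (γ.leave (i + 1)) with h | h | h | h
    · exact absurd h hl1
    · exact absurd h.symm hl2
    · rcases hor (r (i + 1)) with h' | h' | h' | h'
      · exact absurd h'.symm hr1'
      · exact absurd h'.symm hr2'
      · exact absurd (h.trans h'.symm) hr3'
      · rw [h, h', hcross]
    · rcases hor (r (i + 1)) with h' | h' | h' | h'
      · exact absurd h'.symm hr1'
      · exact absurd h'.symm hr2'
      · rw [h, h', crossingCount_comm, hcross]
      · exact absurd (h.trans h'.symm) hr3'
  rw [hsum, Finset.sum_sub_distrib, sub_eq_zero, ← Equiv.sum_comp (Equiv.addRight (1 : Fin γ.n))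
    (fun i => crossingCount P (γ.tri i).1 (γ.tri i).2 (γ.leave i) (r i))]
  exact Finset.sum_congr rfl fun i _ => (hstep i).symm

end IdealTriangulation

/-! ### Ascending and descending ladders, and their effect on a tetrahedron -/

namespace IdealTriangulation

variable {T : Type*} {𝒯 : IdealTriangulation T} {θ : AngleVector T} {into : T → Fin 4 → Prop}

theorem IsTransverseTaut.exists_frame (h : 𝒯.IsTransverseTaut θ into) (t : T) :
    ∃ p : EvenFrame, θ t (oppPair (p.1 0) (p.1 1)) = Real.pi ∧
      into t (p.1 0) ∧ into t (p.1 1) ∧ ¬ into t (p.1 2) ∧ ¬ into t (p.1 3) := by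
  obtain ⟨p, h01, -, h0, h1, h2, h3⟩ := h.2 t
  rcases Int.units_eq_one_or (Equiv.Perm.sign p) with hp | hp
  · exact ⟨⟨p, hp⟩, h01, h0, h1, h2, h3⟩
  · refine ⟨⟨p * Equiv.swap 2 3, ?_⟩, h01, h0, h1, h3, h2⟩
    rw [Equiv.Perm.sign_mul, hp]
    decide

open Classical in
/-- The pair of thin edges that have the color of the edge from `p 0` to `p 1`, if the latter is
wide. -/
noncomputable def sameColorPair (𝒯 : IdealTriangulation T) (θ : AngleVector T) (t : T)
    (p : EvenFrame) : Fin 3 :=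
  if 𝒯.Red θ t (p.1 0) (p.1 1) then oppPair (p.1 0) (p.1 3) else oppPair (p.1 0) (p.1 2)

/-- This is why the triangles at the two ends of a `π`-edge push its angle to the same pair. -/
theorem sameColorPair_reverse {t : T} {p r : EvenFrame} (h0 : r.1 0 = p.1 1) (h1 : r.1 1 = p.1 0)
    (h2 : r.1 2 = p.1 3) (h3 : r.1 3 = p.1 2) :
    𝒯.sameColorPair θ t r = 𝒯.sameColorPair θ t p := by
  unfold sameColorPair
  rw [h0, h1, h2, h3, p.oppPair_opposite.2.1, p.oppPair_opposite.2.2,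
    propext (⟨Red.symm, Red.symm⟩ :
      𝒯.Red θ t (p.1 1) (p.1 0) ↔ 𝒯.Red θ t (p.1 0) (p.1 1))]

theorem oppPair_ne_sameColorPair (t : T) (p : EvenFrame) :
    oppPair (p.1 0) (p.1 1) ≠ 𝒯.sameColorPair θ t p := by
  unfold sameColorPair
  split_ifs
  · exact p.oppPair_distinct.2.1
  · exact p.oppPair_distinct.1

/-- The face of `t` opposite `a` has two red edges. -/
def TwoRedEdges (𝒯 : IdealTriangulation T) (θ : AngleVector T) (t : T) (a : Fin 4) : Prop :=
  ∃ j k l, j ≠ a ∧ k ≠ a ∧ l ≠ a ∧ k ≠ l ∧ 𝒯.Red θ t j k ∧ 𝒯.Red θ t j l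

theorem TwoRedEdges.across {t : T} {a : Fin 4} (h : 𝒯.TwoRedEdges θ t a) :
    𝒯.TwoRedEdges θ (𝒯.adj t a) (𝒯.glue t a a) := by
  obtain ⟨j, k, l, hj, hk, hl, hkl, h1, h2⟩ := h
  have hg := (𝒯.glue t a).injective
  exact ⟨_, _, _, hg.ne hj, hg.ne hk, hg.ne hl, hg.ne hkl,
    (𝒯.red_across t hj.symm hk.symm).2 h1, (𝒯.red_across t hj.symm hl.symm).2 h2⟩

theorem twoRedEdges_across_iff (t : T) (a : Fin 4) :
    𝒯.TwoRedEdges θ (𝒯.adj t a) (𝒯.glue t a a) ↔ 𝒯.TwoRedEdges θ t a := by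
  refine ⟨fun h => ?_, TwoRedEdges.across⟩
  have := h.across
  rw [𝒯.adj_adj, 𝒯.glue_glue] at this
  simpa using this

variable [Fintype T]

/-- The faces sharing a `π`-edge point in the same direction, and the other two in the opposite
direction. -/
theorem IsTransverseTaut.into_wide_iff (h : 𝒯.IsTransverseTaut θ into)
    (hθ : 𝒯.IsTautAngleStructure θ) {t : T} {v w e : Fin 4} (hw : w ≠ v) (he : e ≠ v)
    (hew : e ≠ w) (hwide : θ t (oppPair v w) = Real.pi) :
    (into t w ↔ into t v) ∧ (into t e ↔ ¬ into t w) := by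
  obtain ⟨p, hp, h0, h1, h2, h3⟩ := h.exists_frame t
  have hq := hθ.eq_of_wide hwide hp
  rw [oppPair_eq_iff _ _ _ _ v w (p.ne (show (0 : Fin 4) ≠ 1 by decide))
    (p.ne (show (0 : Fin 4) ≠ 2 by decide)) (p.ne (show (0 : Fin 4) ≠ 3 by decide))
    (p.ne (show (1 : Fin 4) ≠ 2 by decide)) (p.ne (show (1 : Fin 4) ≠ 3 by decide))
    (p.ne (show (2 : Fin 4) ≠ 3 by decide)) hw] at hq
  rcases hq with ⟨rfl, rfl⟩ | ⟨rfl, rfl⟩ | ⟨rfl, rfl⟩ | ⟨rfl, rfl⟩ <;>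
  rcases p.eq_or e with rfl | rfl | rfl | rfl <;> simp_all

theorem hasTriangle_ascending_iff (hθ : 𝒯.IsTautAngleStructure θ) {t : T} {v w : Fin 4}
    (hw : w ≠ v) (hwide : θ t (oppPair v w) = Real.pi) :
    LadderType.HasTriangle θ into (t, v) .ascending ↔ into t w := by
  refine ⟨fun H => H w hw hwide, fun H a ha hwa => ?_⟩
  rwa [oppPair_left_injective _ _ _ ha.symm hw.symm (hθ.eq_of_wide hwa hwide)]

theorem hasTriangle_descending_iff (hθ : 𝒯.IsTautAngleStructure θ) {t : T} {v w : Fin 4}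
    (hw : w ≠ v) (hwide : θ t (oppPair v w) = Real.pi) :
    LadderType.HasTriangle θ into (t, v) .descending ↔ ¬ into t w := by
  refine ⟨fun H => H w hw hwide, fun H a ha hwa => ?_⟩
  rwa [oppPair_left_injective _ _ _ ha.symm hw.symm (hθ.eq_of_wide hwa hwide)]

/-- The ascending triangles truncate the ends of one `π`-edge of a tetrahedron, the descending ones
the ends of the other. -/
theorem IsTransverseTaut.exists_typeFrame (h : 𝒯.IsTransverseTaut θ into)
    (hθ : 𝒯.IsTautAngleStructure θ) (t : T) :
    ∃ p : EvenFrame, θ t (oppPair (p.1 0) (p.1 1)) = Real.pi ∧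
      (∀ v, LadderType.HasTriangle θ into (t, v) .ascending ↔ v = p.1 0 ∨ v = p.1 1) ∧
      (∀ v, LadderType.HasTriangle θ into (t, v) .descending ↔ v = p.1 2 ∨ v = p.1 3) := by
  obtain ⟨p, hp, h0, h1, h2, h3⟩ := h.exists_frame t
  have h01 : p.1 0 ≠ p.1 1 := p.ne (by decide)
  have h23 : p.1 2 ≠ p.1 3 := p.ne (by decide)
  have h02 : p.1 0 ≠ p.1 2 := p.ne (by decide)
  have h03 : p.1 0 ≠ p.1 3 := p.ne (by decide)
  have h12 : p.1 1 ≠ p.1 2 := p.ne (by decide)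
  have h13 : p.1 1 ≠ p.1 3 := p.ne (by decide)
  have hp10 : θ t (oppPair (p.1 1) (p.1 0)) = Real.pi := by rw [oppPair_comm, hp]
  have hp23 : θ t (oppPair (p.1 2) (p.1 3)) = Real.pi := by rw [p.oppPair_opposite.1, hp]
  have hp32 : θ t (oppPair (p.1 3) (p.1 2)) = Real.pi := by rw [oppPair_comm, hp23]
  refine ⟨p, hp, fun v => ?_, fun v => ?_⟩
  · rcases p.eq_or v with rfl | rfl | rfl | rfl
    · simp [hasTriangle_ascending_iff hθ h01.symm hp, h1]
    · simp [hasTriangle_ascending_iff hθ h01 hp10, h0]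
    · simp [hasTriangle_ascending_iff hθ h23.symm hp23, h3, h02.symm, h12.symm]
    · simp [hasTriangle_ascending_iff hθ h23 hp32, h2, h03.symm, h13.symm]
  · rcases p.eq_or v with rfl | rfl | rfl | rfl
    · simp [hasTriangle_descending_iff hθ h01.symm hp, h1, h02, h03]
    · simp [hasTriangle_descending_iff hθ h01 hp10, h0, h12, h13]
    · simp [hasTriangle_descending_iff hθ h23.symm hp23, h3]
    · simp [hasTriangle_descending_iff hθ h23 hp32, h2]

variable {W E : CuspTriangle T → Fin 4}

/-- Two reversals cancel: a face pointing out of one tetrahedron points into the next, and there the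
faces opposite `E` and `W` point in opposite directions. -/
theorem IsTransverseTaut.into_ladderStep_iff (ht : 𝒯.IsTransverseTaut θ into)
    (hθ : 𝒯.IsTautAngleStructure θ) (hv : 𝒯.IsVeering θ)
    (h : ∀ x, 𝒯.WideThin θ x (W x) (E x)) (x : CuspTriangle T) :
    into (ladderStep hθ hv h x).1 (W (ladderStep hθ hv h x)) ↔ into x.1 (W x) := by
  have hy := h (ladderStep hθ hv h x)
  have h1 := (ht.into_wide_iff hθ hy.wide_ne hy.thin_ne hy.thin_ne_wide hy.wide).2
  have h2 : E (ladderStep hθ hv h x) = _ := thin_across_wide hθ hv h x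
  rw [h2] at h1
  have h3 := ht.1 x.1 (W x)
  have h4 : (ladderStep hθ hv h x).1 = 𝒯.adj x.1 (W x) := rfl
  rw [h4] at h1 ⊢
  tauto

/-- All triangles of a ladder have the same type. -/
theorem IsTransverseTaut.hasTriangle_iff_of_sameCycle (ht : 𝒯.IsTransverseTaut θ into)
    (hθ : 𝒯.IsTautAngleStructure θ) (hv : 𝒯.IsVeering θ)
    (h : ∀ x, 𝒯.WideThin θ x (W x) (E x)) {x y : CuspTriangle T}
    (hxy : (ladderStep hθ hv h).SameCycle x y) (k : LadderType) :
    k.HasTriangle θ into x ↔ k.HasTriangle θ into y := by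
  have key : into x.1 (W x) ↔ into y.1 (W y) := by
    obtain ⟨n, rfl⟩ := hxy.exists_nat_pow_eq
    clear hxy
    induction n with
    | zero => rfl
    | succ n ih =>
      rw [pow_succ', Equiv.Perm.mul_apply, ht.into_ladderStep_iff hθ hv h, ih]
  cases k
  · rw [hasTriangle_ascending_iff hθ (h x).wide_ne (h x).wide,
      hasTriangle_ascending_iff hθ (h y).wide_ne (h y).wide, key]
  · rw [hasTriangle_descending_iff hθ (h x).wide_ne (h x).wide,
      hasTriangle_descending_iff hθ (h y).wide_ne (h y).wide, key]

open Classical in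
/-- The sum of the deformations along all ladders of a type is a sum over all triangles of
that type. -/
theorem IsTransverseTaut.sum_deformation (ht : 𝒯.IsTransverseTaut θ into)
    (hθ : 𝒯.IsTautAngleStructure θ) (hv : 𝒯.IsVeering θ)
    (h : ∀ x, 𝒯.WideThin θ x (W x) (E x)) {k : LadderType}
    {γ : 𝒯.LadderOfType θ into k → 𝒯.NormalCurve} (hγ : ∀ L, (γ L).RunsAlong θ L.1) :
    ∑ L, (γ L).deformation =
      ∑ x with k.HasTriangle θ into x, (basisVector x (E x) - basisVector x (W x)) := by
  simp only [fun L => deformation_eq_sum hθ h (hγ L), Finset.sum_filter]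
  rw [Finset.sum_comm]
  refine Finset.sum_congr rfl fun x _ => ?_
  split_ifs with hx
  · have hL (y) (hy : Relation.EqvGen (𝒯.RungAdj θ) x y) : k.HasTriangle θ into y :=
      (ht.hasTriangle_iff_of_sameCycle hθ hv h ((eqvGen_rungAdj_iff hθ hv h x y).1 hy) k).1 hx
    -- A triangle of type `k` lies in exactly one ladder, its own component, and that ladder has
    -- type `k` throughout.
    refine (Finset.sum_eq_single (ι := 𝒯.LadderOfType θ into k)
      ⟨{y | Relation.EqvGen (𝒯.RungAdj θ) x y}, ⟨x, rfl⟩, hL⟩ ?_ ?_).trans ?_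
    · intro L _ hne
      refine if_neg fun hxL => hne (Subtype.ext ?_)
      obtain ⟨z, hz⟩ := L.2.1
      rw [hz] at hxL ⊢
      ext y
      exact ⟨fun hy => .trans _ _ _ (.symm _ _ hxL) hy, fun hy => .trans _ _ _ hxL hy⟩
    · exact fun H => absurd (Finset.mem_univ _) H
    · exact if_pos (Relation.EqvGen.refl x)
  · exact Finset.sum_eq_zero (ι := 𝒯.LadderOfType θ into k) fun L _ =>
      if_neg fun hxL => hx (L.2.2 x hxL)

theorem oppPair_thin (hθ : 𝒯.IsTautAngleStructure θ) (hv : 𝒯.IsVeering θ)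
    (h : ∀ x, 𝒯.WideThin θ x (W x) (E x)) {t : T} (p : EvenFrame)
    (hp : θ t (oppPair (p.1 0) (p.1 1)) = Real.pi) :
    oppPair (p.1 0) (E (t, p.1 0)) = 𝒯.sameColorPair θ t p := by
  unfold sameColorPair
  split_ifs with hr
  · rw [((h _).unique hθ (wideThin_of_red hθ hv p hp hr)).2]
  · have hb := (hv.blue_or_red t (p.ne (show (1 : Fin 4) ≠ 0 by decide))).resolve_right hr
    rw [((h _).unique hθ (wideThin_of_blue hθ hv p hp hb)).2]

open Classical in
theorem sum_basisVector_apply (hθ : 𝒯.IsTautAngleStructure θ) (hv : 𝒯.IsVeering θ)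
    (h : ∀ x, 𝒯.WideThin θ x (W x) (E x)) {k : LadderType} {t : T} {p : EvenFrame}
    (hp : θ t (oppPair (p.1 0) (p.1 1)) = Real.pi)
    (hk : ∀ v, k.HasTriangle θ into (t, v) ↔ v = p.1 0 ∨ v = p.1 1) (q : Fin 3) :
    (∑ x with k.HasTriangle θ into x, (basisVector x (E x) - basisVector x (W x))) t q =
      2 * (if 𝒯.sameColorPair θ t p = q then 1 else 0) -
        2 * (if oppPair (p.1 0) (p.1 1) = q then 1 else 0) := by
  have h01 : p.1 0 ≠ p.1 1 := p.ne (by decide)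
  have hfilter : Finset.univ.filter (fun v => v = p.1 0 ∨ v = p.1 1) = {p.1 0, p.1 1} := by
    ext v; simp
  rw [Finset.sum_apply, Finset.sum_apply, Finset.sum_filter, Fintype.sum_prod_type,
    Finset.sum_eq_single t]
  · obtain ⟨r, r0, r1, r2, r3⟩ := p.exists_reverse
    have hr : θ t (oppPair (r.1 0) (r.1 1)) = Real.pi := by rw [r0, r1, oppPair_comm, hp]
    have hW0 : p.1 1 = W (t, p.1 0) := (h (t, p.1 0)).eq_wide hθ h01.symm hp
    have hW1 : p.1 0 = W (t, p.1 1) :=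
      (h (t, p.1 1)).eq_wide hθ h01 (by rw [oppPair_comm, hp])
    have hE0 := oppPair_thin hθ hv h p hp
    have hE1 := oppPair_thin hθ hv h r hr
    rw [sameColorPair_reverse r0 r1 r2 r3, r0] at hE1
    simp only [hk]
    rw [← Finset.sum_filter, hfilter, Finset.sum_pair h01]
    simp only [Pi.sub_apply, basisVector_apply, true_and, hE0, hE1, ← hW0, ← hW1,
      oppPair_comm (p.1 1) (p.1 0)]
    ring
  · intro s _ hs
    refine Finset.sum_eq_zero fun v _ => ?_
    simp [basisVector_apply, hs.symm]
  · exact fun H => absurd (Finset.mem_univ _) H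

open Classical in
/-- The deformation moves the angle `π` of a tetrahedron to thin edges. -/
theorem IsLadderDeformation.apply (ht : 𝒯.IsTransverseTaut θ into)
    (hθ : 𝒯.IsTautAngleStructure θ) (hv : 𝒯.IsVeering θ) {k : LadderType} {θ' : AngleVector T}
    (hθ' : 𝒯.IsLadderDeformation θ into k θ') {t : T} {p : EvenFrame}
    (hp : θ t (oppPair (p.1 0) (p.1 1)) = Real.pi)
    (hk : ∀ v, k.HasTriangle θ into (t, v) ↔ v = p.1 0 ∨ v = p.1 1) (q : Fin 3) :
    θ' t q = if 𝒯.sameColorPair θ t p = q then Real.pi else 0 := by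
  obtain ⟨W, E, h⟩ := exists_wideThin_fun hθ hv
  obtain ⟨γ, hγ, rfl⟩ := hθ'
  rw [ht.sum_deformation hθ hv h hγ]
  have hq : θ t q = if oppPair (p.1 0) (p.1 1) = q then Real.pi else 0 := by
    split_ifs with hq
    · rw [← hq, hp]
    · exact hθ.thin hp hq
  rw [Pi.add_apply, Pi.add_apply, Pi.smul_apply, Pi.smul_apply, sum_basisVector_apply hθ hv h hp hk,
    hq, smul_eq_mul]
  -- The two triangles give the factor `2`, so the weight `π / 2` moves exactly `π`.
  split_ifs <;> ring

theorem exists_isLadderDeformation (hθ : 𝒯.IsTautAngleStructure θ) (hv : 𝒯.IsVeering θ)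
    (into : T → Fin 4 → Prop) (k : LadderType) : ∃ θ', 𝒯.IsLadderDeformation θ into k θ' := by
  obtain ⟨W, E, h⟩ := exists_wideThin_fun hθ hv
  refine ⟨_, fun L => ladderCurve hθ hv h L.2.1.choose, fun L => ?_, rfl⟩
  have := ladderCurve_runsAlong hθ hv h L.2.1.choose
  rwa [← L.2.1.choose_spec] at this

/-- Each single curve already preserves the sum. Describing `s` by membership leaves the
decidability instance open. -/
theorem IsLadderDeformation.sum_angle_eq {k : LadderType} {θ' : AngleVector T}
    (hθ' : 𝒯.IsLadderDeformation θ into k θ') (s : Finset (Corner T)) (c : Corner T)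
    (hs : ∀ d, d ∈ s ↔ 𝒯.SameVertex c d) : ∑ d ∈ s, θ'.angle d = ∑ d ∈ s, θ.angle d := by
  classical
  obtain ⟨γ, -, rfl⟩ := hθ'
  have hs' : s = Finset.univ.filter (𝒯.SameVertex c) := by
    ext d; simp [hs]
  have (d : Corner T) : AngleVector.angle (θ + (Real.pi / 2) • ∑ L, (γ L).deformation) d =
      θ.angle d + Real.pi / 2 * ∑ L, (γ L).deformation.angle d := by
    simp [AngleVector.angle, Finset.sum_apply]
  simp only [this, Finset.sum_add_distrib, ← Finset.mul_sum]
  rw [Finset.sum_comm, add_eq_left, Finset.sum_eq_zero, mul_zero]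
  intro L _
  rw [hs']
  exact (γ L).sum_deformation_angle (𝒯.sameVertex_congr c)

/-- The half turn exchanging the two `π`-edges gives the descending type the same normal form as the
ascending one. -/
theorem IsTransverseTaut.exists_frame_of_type (h : 𝒯.IsTransverseTaut θ into)
    (hθ : 𝒯.IsTautAngleStructure θ) (k : LadderType) (t : T) :
    ∃ p : EvenFrame, θ t (oppPair (p.1 0) (p.1 1)) = Real.pi ∧
      ∀ v, k.HasTriangle θ into (t, v) ↔ v = p.1 0 ∨ v = p.1 1 := by
  obtain ⟨p, hp, ha, hd⟩ := h.exists_typeFrame hθ t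
  cases k
  · exact ⟨p, hp, ha⟩
  · obtain ⟨r, r0, r1, -, -⟩ := p.exists_opposite
    refine ⟨r, ?_, ?_⟩
    · rw [r0, r1, p.oppPair_opposite.1, hp]
    · rwa [r0, r1]

theorem IsLadderDeformation.isTautAngleStructure (ht : 𝒯.IsTransverseTaut θ into)
    (hθ : 𝒯.IsTautAngleStructure θ) (hv : 𝒯.IsVeering θ) {k : LadderType} {θ' : AngleVector T}
    (hθ' : 𝒯.IsLadderDeformation θ into k θ') : 𝒯.IsTautAngleStructure θ' := by
  refine ⟨⟨fun t => ?_, fun c => ?_⟩, fun t q => ?_⟩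
  · obtain ⟨p, hp, hk⟩ := ht.exists_frame_of_type hθ k t
    rw [← Fin.sum_univ_three, Finset.sum_congr rfl fun q _ => hθ'.apply ht hθ hv hp hk q]
    simp
  · exact (hθ'.sum_angle_eq _ c (by simp)).trans (hθ.1.2 c)
  · obtain ⟨p, hp, hk⟩ := ht.exists_frame_of_type hθ k t
    rw [hθ'.apply ht hθ hv hp hk q]
    split_ifs
    · exact Or.inr rfl
    · exact Or.inl rfl

theorem IsLadderDeformation.ne [Nonempty T] (ht : 𝒯.IsTransverseTaut θ into)
    (hθ : 𝒯.IsTautAngleStructure θ) (hv : 𝒯.IsVeering θ) {k : LadderType} {θ' : AngleVector T}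
    (hθ' : 𝒯.IsLadderDeformation θ into k θ') : θ' ≠ θ := by
  rintro rfl
  obtain ⟨t⟩ := ‹Nonempty T›
  obtain ⟨p, hp, hk⟩ := ht.exists_frame_of_type hθ k t
  have := hθ'.apply ht hθ hv hp hk (oppPair (p.1 0) (p.1 1))
  rw [if_neg (oppPair_ne_sameColorPair t p).symm, hp] at this
  exact Real.pi_ne_zero this

/-! ### Hinges, and the difference between the two deformations -/

/-- In a tetrahedron whose `π`-edges are both red, every face has two red edges. -/
theorem twoRedEdges_of_red (hθ : 𝒯.IsTautAngleStructure θ) (hv : 𝒯.IsVeering θ) {t : T}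
    (H : ∀ v w, w ≠ v → θ t (oppPair v w) = Real.pi → 𝒯.Red θ t v w) (a : Fin 4) :
    𝒯.TwoRedEdges θ t a := by
  obtain ⟨p, rfl, hp⟩ := hθ.exists_wide t a
  have hr := red_of_wide hθ hv p hp
  obtain ⟨r, r0, r1, r2, r3⟩ := p.exists_reverse
  have hr' := red_of_wide hθ hv r (by rw [r0, r1, oppPair_comm, hp])
  rw [r0, r3] at hr'
  refine ⟨p.1 2, p.1 1, p.1 3, p.ne (by decide), p.ne (by decide), p.ne (by decide),
    p.ne (by decide), hr'.symm, H _ _ (p.ne (by decide)) ?_⟩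
  rw [p.oppPair_opposite.1, hp]

/-- In a tetrahedron whose `π`-edges are both blue, no face has two red edges. -/
theorem not_twoRedEdges_of_blue (hθ : 𝒯.IsTautAngleStructure θ) (hv : 𝒯.IsVeering θ) {t : T}
    (H : ∀ v w, w ≠ v → θ t (oppPair v w) = Real.pi → 𝒯.Blue θ t v w) (a : Fin 4) :
    ¬ 𝒯.TwoRedEdges θ t a := by
  rintro ⟨j, k, l, -, -, -, hkl, h1, h2⟩
  obtain ⟨p, rfl, hp⟩ := hθ.exists_wide t j
  have key (k : Fin 4) (hk : 𝒯.Red θ t (p.1 0) k) : k = p.1 3 := by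
    rcases p.eq_or k with rfl | rfl | rfl | rfl
    · exact absurd rfl hk.1
    · exact (not_blue_and_red hθ hv (H _ _ (p.ne (by decide)) hp) hk).elim
    · exact (not_blue_and_red hθ hv (blue_of_wide hθ hv p hp) hk).elim
    · rfl
  exact hkl ((key k h1).trans (key l h2).symm)

theorem exists_sameVertex_wide (hθ : 𝒯.IsTautAngleStructure θ) (c : Corner T) :
    ∃ d, 𝒯.SameVertex c d ∧ θ.angle d = Real.pi := by
  classical
  by_contra! H
  have := (hθ.1.2 c).symm.trans (Finset.sum_eq_zero fun d hd =>
    (hθ.2 _ _).resolve_right (H d (Finset.mem_filter.1 hd).2))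
  linarith [Real.pi_pos]

/-- There is a hinge: a tetrahedron whose `π`-edges have different colors. -/
theorem exists_hinge [Nonempty T] (hθ : 𝒯.IsTautAngleStructure θ) (hv : 𝒯.IsVeering θ) :
    ∃ t, ∃ v w v' w' : Fin 4, θ t (oppPair v w) = Real.pi ∧ θ t (oppPair v' w') = Real.pi ∧
      𝒯.Red θ t v w ∧ 𝒯.Blue θ t v' w' := by
  by_contra! H
  have hor (t : T) : (∀ v w, w ≠ v → θ t (oppPair v w) = Real.pi → 𝒯.Red θ t v w) ∨
      (∀ v w, w ≠ v → θ t (oppPair v w) = Real.pi → 𝒯.Blue θ t v w) := by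
    by_cases hr : ∃ v w, θ t (oppPair v w) = Real.pi ∧ 𝒯.Red θ t v w
    · obtain ⟨v, w, hw, hr⟩ := hr
      exact Or.inl fun v' w' hne hw' =>
        (hv.blue_or_red t hne).resolve_left (H t v w v' w' hw hw' hr)
    · push Not at hr
      exact Or.inr fun v w hne hw => (hv.blue_or_red t hne).resolve_right (hr v w hw)
  -- Without hinges, the `π`-edges of a tetrahedron share a colour, which decides the type of all
  -- four faces at once.
  have hall (t : T) (a b : Fin 4) : 𝒯.TwoRedEdges θ t a ↔ 𝒯.TwoRedEdges θ t b := by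
    rcases hor t with h | h
    · exact iff_of_true (twoRedEdges_of_red hθ hv h a) (twoRedEdges_of_red hθ hv h b)
    · exact iff_of_false (not_twoRedEdges_of_blue hθ hv h a) (not_twoRedEdges_of_blue hθ hv h b)
  have hadj (c d : Corner T) (h : 𝒯.SameVertex c d) :
      𝒯.TwoRedEdges θ c.tet 0 ↔ 𝒯.TwoRedEdges θ d.tet 0 := by
    induction h with
    | rel c d h =>
      obtain ⟨a, -, -, h, -, -⟩ := h
      rw [h, hall c.tet 0 a, ← twoRedEdges_across_iff, hall]
    | refl => rfl
    | symm _ _ _ ih => exact ih.symm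
    | trans _ _ _ _ _ ih1 ih2 => exact ih1.trans ih2
  obtain ⟨t⟩ := ‹Nonempty T›
  obtain ⟨p, -, hp⟩ := hθ.exists_wide t 0
  rcases hor t with h | h
  · obtain ⟨hne, hb⟩ := blue_of_wide hθ hv p hp
    -- Around a blue thin edge of `t` some angle is `π`, so a tetrahedron `t'` there has a blue
    -- `π`-edge, although its faces have the type of those of `t`.
    obtain ⟨⟨t', v, w, hvw⟩, hcd, hd⟩ := exists_sameVertex_wide hθ ⟨t, p.1 0, p.1 2, hne⟩
    have hb' : 𝒯.Blue θ t' v w := ⟨hvw, (𝒯.leftVeering_congr θ _ _ hcd).1 hb⟩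
    rcases hor t' with h' | h'
    · exact not_blue_and_red hθ hv hb' (h' v w hvw hd)
    · exact not_twoRedEdges_of_blue hθ hv h' 0
        ((hadj _ _ hcd).1 (twoRedEdges_of_red hθ hv h 0))
  · obtain ⟨hne, hr⟩ := red_of_wide hθ hv p hp
    obtain ⟨⟨t', v, w, hvw⟩, hcd, hd⟩ := exists_sameVertex_wide hθ ⟨t, p.1 0, p.1 3, hne⟩
    have hr' : 𝒯.Red θ t' v w := ⟨hvw, (𝒯.rightVeering_congr θ _ _ hcd).1 hr⟩
    rcases hor t' with h' | h'
    · exact not_twoRedEdges_of_blue hθ hv h 0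
        ((hadj _ _ hcd).2 (twoRedEdges_of_red hθ hv h' 0))
    · exact not_blue_and_red hθ hv (h' v w hvw hd) hr'

/-- The two deformations differ at a hinge. -/
theorem ascending_ne_descending [Nonempty T] (ht : 𝒯.IsTransverseTaut θ into)
    (hθ : 𝒯.IsTautAngleStructure θ) (hv : 𝒯.IsVeering θ) {θ₁ θ₂ : AngleVector T}
    (h₁ : 𝒯.IsLadderDeformation θ into .ascending θ₁)
    (h₂ : 𝒯.IsLadderDeformation θ into .descending θ₂) : θ₁ ≠ θ₂ := by
  rintro rfl
  obtain ⟨t, v, w, v', w', hw, hw', hr, hb⟩ := exists_hinge hθ hv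
  obtain ⟨p, hp, ha, hd⟩ := ht.exists_typeFrame hθ t
  obtain ⟨r, r0, r1, r2, r3⟩ := p.exists_opposite
  have hpr : θ t (oppPair (r.1 0) (r.1 1)) = Real.pi := by
    rw [r0, r1, p.oppPair_opposite.1, hp]
  have hrd : ∀ v, LadderType.HasTriangle θ into (t, v) .descending ↔ v = r.1 0 ∨ v = r.1 1 := by
    rwa [r0, r1]
  have heq := h₁.apply ht hθ hv hp ha (𝒯.sameColorPair θ t p)
  rw [h₂.apply ht hθ hv hpr hrd, if_pos rfl] at heq
  have hc : 𝒯.sameColorPair θ t r = 𝒯.sameColorPair θ t p := by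
    by_contra hne
    rw [if_neg hne] at heq
    exact Real.pi_ne_zero heq.symm
  -- The red and the blue thin pair are the same seen from either `π`-edge, so equal target pairs
  -- mean `π`-edges of equal colour.
  have hiff : 𝒯.Red θ t (p.1 0) (p.1 1) ↔ 𝒯.Red θ t (p.1 2) (p.1 3) := by
    unfold sameColorPair at hc
    rw [r0, r1, r2, r3, oppPair_comm (p.1 2) (p.1 1), p.oppPair_opposite.2.2,
      oppPair_comm (p.1 2) (p.1 0)] at hc
    have hne := p.oppPair_distinct.2.2
    split_ifs at hc with h h' h'
    · exact iff_of_true h' h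
    · exact absurd hc hne.symm
    · exact absurd hc hne
    · exact iff_of_false h' h
  have key (v w : Fin 4) (hne : w ≠ v) (hw : θ t (oppPair v w) = Real.pi) :
      𝒯.Red θ t v w ↔ 𝒯.Red θ t (p.1 0) (p.1 1) := by
    have hq := hθ.eq_of_wide hw hp
    rw [oppPair_eq_iff _ _ _ _ v w (p.ne (show (0 : Fin 4) ≠ 1 by decide))
      (p.ne (show (0 : Fin 4) ≠ 2 by decide)) (p.ne (show (0 : Fin 4) ≠ 3 by decide))
      (p.ne (show (1 : Fin 4) ≠ 2 by decide)) (p.ne (show (1 : Fin 4) ≠ 3 by decide))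
      (p.ne (show (2 : Fin 4) ≠ 3 by decide)) hne] at hq
    rcases hq with ⟨rfl, rfl⟩ | ⟨rfl, rfl⟩ | ⟨rfl, rfl⟩ | ⟨rfl, rfl⟩
    · rfl
    · exact ⟨Red.symm, Red.symm⟩
    · exact hiff.symm
    · exact Iff.trans ⟨Red.symm, Red.symm⟩ hiff.symm
  exact not_blue_and_red hθ hv hb ((key v' w' hb.1 hw').2 ((key v w hr.1 hw).1 hr))

end IdealTriangulation

theorem proposition5p7 {T : Type*} [Fintype T] [Nonempty T] (𝒯 : IdealTriangulation T)
    (θ : AngleVector T) (hθ : 𝒯.IsTautAngleStructure θ) (hveer : 𝒯.IsVeering θ)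
    (into : T → Fin 4 → Prop) (htrans : 𝒯.IsTransverseTaut θ into) :
    ∃ θ₁ θ₂ : AngleVector T,
      𝒯.IsTautAngleStructure θ₁ ∧ 𝒯.IsTautAngleStructure θ₂ ∧
      θ₁ ≠ θ ∧ θ₂ ≠ θ ∧ θ₁ ≠ θ₂ ∧
      𝒯.IsLadderDeformation θ into .ascending θ₁ ∧
      𝒯.IsLadderDeformation θ into .descending θ₂ := by
  obtain ⟨θ₁, h₁⟩ := IdealTriangulation.exists_isLadderDeformation hθ hveer into .ascending
  obtain ⟨θ₂, h₂⟩ := IdealTriangulation.exists_isLadderDeformation hθ hveer into .descending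
  exact ⟨θ₁, θ₂, h₁.isTautAngleStructure htrans hθ hveer, h₂.isTautAngleStructure htrans hθ hveer,
    h₁.ne htrans hθ hveer, h₂.ne htrans hθ hveer,
    IdealTriangulation.ascending_ne_descending htrans hθ hveer h₁ h₂, h₁, h₂⟩
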